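/- Let $k$ be an algebraically closed field and let $n\ge 0$ be an integer. Let $\Lambda_n = kQ/J^2$ be the linear radical square zero Nakayama algebra of rank $n$ over $k$, where $Q$ is the linear quiver $1\to 2\to\cdots\to n$, $kQ$ is its path algebra and $J\subset kQ$ is the two-sided ideal generated by the arrows. A finitely generated $\Lambda_n$-module $M$ is called exceptional if it is indecomposable, $\operatorname{Hom}_{\Lambda_n}(M,M)\cong k$, and $\operatorname{Ext}^i_{\Lambda_n}(M,M)=0$ for all $i\ge 1$. A complete exceptional sequence of $\Lambda_n$ is a sequence $(M_1,\dots,M_n)$ of $n$ isomorphism classes of exceptional $\Lambda_n$-modules such that $\operatorname{Hom}_{\Lambda_n}(M_j,M_i)=0$ and $\operatorname{Ext}^l_{\Lambda_n}(M_j,M_i)=0$ for all $l\ge 1$ and all $1\le i<j\le n$. A rooted forest is an acyclic graph in which exactly one vertex (the root) is distinguished in each connected component; it has height at most one if every vertex is at distance at most one from the root of its component. Then the following three sets are in bijection with each other: 1. the set of labeled rooted forests of height at most one on the vertex set $\{1,\dots,n\}$; 2. the set of idempotent functions on $\{1,\dots,n\}$, that is, of functions $f:\{1,\dots,n\}\to\{1,\dots,n\}$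 with $f\circ f=f$; 3. the set of complete exceptional sequences of $\Lambda_n$. -/

import Mathlib

universe u

namespace Nakayama

open CategoryTheory

/-- Generators of the path algebra of the linear quiver `1 → 2 → ⋯ → n` (vertices are indexed by
`Fin n`): one trivial path for every vertex and one arrow `i ⟶ j` whenever `j` is the immediate
successor of `i`. -/
inductive Gen (n : ℕ) : Type
  | vertex (i : Fin n) : Gen n
  | arrow (i j : Fin n) (h : (i : ℕ) + 1 = (j : ℕ)) : Gen n

/-- The trivial path at the vertex `i`, as an element of the free algebra. -/
abbrev freeVertex (k : Type u) [Field k] (n : ℕ) (i : Fin n) : FreeAlgebra k (Gen n) :=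
  FreeAlgebra.ι k (Gen.vertex i)

/-- The arrow `i ⟶ j`, as an element of the free algebra. -/
abbrev freeArrow (k : Type u) [Field k] (n : ℕ) (i j : Fin n) (h : (i : ℕ) + 1 = (j : ℕ)) :
    FreeAlgebra k (Gen n) :=
  FreeAlgebra.ι k (Gen.arrow i j h)

/-- The defining relations. The first five families present the path algebra of the linear quiver
(the trivial paths are orthogonal idempotents with sum `1`, and the arrow `i ⟶ j` starts at `i`
and ends at `j`; paths are composed from right to left, so that a left module is a covariant
representation of the quiver). The last family kills all paths of length two, that is, the square
of the arrow ideal. -/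
inductive Rel (k : Type u) [Field k] (n : ℕ) :
    FreeAlgebra k (Gen n) → FreeAlgebra k (Gen n) → Prop
  | vertex_idem (i : Fin n) :
      Rel k n (freeVertex k n i * freeVertex k n i) (freeVertex k n i)
  | vertex_orth (i j : Fin n) (hij : i ≠ j) :
      Rel k n (freeVertex k n i * freeVertex k n j) 0
  | vertex_sum : Rel k n (∑ i : Fin n, freeVertex k n i) 1
  | arrow_source (i j : Fin n) (h : (i : ℕ) + 1 = (j : ℕ)) :
      Rel k n (freeArrow k n i j h * freeVertex k n i) (freeArrow k n i j h)
  | arrow_target (i j : Fin n) (h : (i : ℕ) + 1 = (j : ℕ)) :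
      Rel k n (freeVertex k n j * freeArrow k n i j h) (freeArrow k n i j h)
  | rad_sq (i j l : Fin n) (h : (i : ℕ) + 1 = (j : ℕ)) (h' : (j : ℕ) + 1 = (l : ℕ)) :
      Rel k n (freeArrow k n j l h' * freeArrow k n i j h) 0

/-- The linear radical square zero Nakayama algebra `Λ_n` over `k`: the path algebra of
`1 → 2 → ⋯ → n` modulo the square of its arrow ideal. -/
abbrev NakayamaAlgebra (k : Type u) [Field k] (n : ℕ) : Type u :=
  RingQuot (Rel k n)

section Exceptional

variable (k : Type u) [Field k] {A : Type u} [Ring A] [Algebra k A]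

/-- A module over the `k`-algebra `A` is exceptional if it is finitely generated and
indecomposable, `Hom_A(M, M) ≅ k`, and `Ext^i_A(M, M) = 0` for all `i ≥ 1`. -/
structure IsExceptional (M : ModuleCat.{u} A) : Prop where
  finite : Module.Finite A M
  indecomposable : Indecomposable M
  end_equiv : Nonempty ((M ⟶ M) ≃ₗ[k] k)
  ext_eq_zero : ∀ i : ℕ, 1 ≤ i → Subsingleton (Abelian.Ext M M i)

/-- `(M, N)` is an exceptional pair: `M` and `N` are exceptional, `Hom_A(N, M) = 0`, and
`Ext^i_A(N, M) = 0` for all `i ≥ 1`. -/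
structure IsExceptionalPair (M N : ModuleCat.{u} A) : Prop where
  left : IsExceptional k M
  right : IsExceptional k N
  hom_eq_zero : Subsingleton (N ⟶ M)
  ext_eq_zero : ∀ i : ℕ, 1 ≤ i → Subsingleton (Abelian.Ext N M i)

/-- `(M_1, …, M_t)` is an exceptional sequence: all members are exceptional and `(M_i, M_j)` is an
exceptional pair for all `i < j`. -/
structure IsExceptionalSequence {t : ℕ} (M : Fin t → ModuleCat.{u} A) : Prop where
  exceptional : ∀ i, IsExceptional k (M i)
  pair : ∀ i j, i < j → IsExceptionalPair k (M i) (M j)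

end Exceptional

/-- Isomorphism classes of `A`-modules. -/
abbrev IsoClass (A : Type u) [Ring A] : Type (u + 1) :=
  Quotient (isIsomorphicSetoid (ModuleCat.{u} A))

/-- The isomorphism class of a module. -/
abbrev isoClass {A : Type u} [Ring A] (M : ModuleCat.{u} A) : IsoClass A :=
  Quotient.mk (isIsomorphicSetoid (ModuleCat.{u} A)) M

/-- The set of complete exceptional sequences of `Λ_n`: sequences of length `n` of isomorphism
classes of modules which are represented by an exceptional sequence of modules. -/
def completeExceptionalSequences (k : Type u) [Field k] (n : ℕ) :
    Set (Fin n → IsoClass (NakayamaAlgebra k n)) :=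
  {E | ∃ M : Fin n → ModuleCat.{u} (NakayamaAlgebra k n),
    IsExceptionalSequence k M ∧ ∀ i, isoClass (M i) = E i}

end Nakayama

/-- A rooted forest with vertex set `V`: an acyclic graph together with a set of roots that
contains exactly one vertex of each connected component. -/
structure RootedForest (V : Type) where
  graph : SimpleGraph V
  roots : Set V
  acyclic : graph.IsAcyclic
  existsUnique_root : ∀ c : graph.ConnectedComponent,
    ∃! r, r ∈ roots ∧ graph.connectedComponentMk r = c

/-- The height of the forest is at most `h`: every vertex of the tree with root `r` is at distance
at most `h` from `r`. -/
def RootedForest.HeightLE {V : Type} (F : RootedForest V) (h : ℕ) : Prop :=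
  ∀ r ∈ F.roots, ∀ v, F.graph.Reachable r v → F.graph.dist r v ≤ h

/-- Labeled rooted forests of height at most one with `n` labeled vertices. -/
def heightLEOneForests (n : ℕ) : Set (RootedForest (Fin n)) :=
  {F | F.HeightLE 1}

/-- Idempotent functions from the set with `n` elements to itself. -/
def idempotentFunctions (n : ℕ) : Set (Fin n → Fin n) :=
  {f | f ∘ f = f}

/-! The indecomposable modules are the simples `S_i` and the length-two modules `P_i`, one for each
arrow `i ⟶ i+1`, with top `S_i` and socle `S_{i+1}`. A nonzero module has one of these as a direct
summand (`exists_indec_retract`). A nonzero summand of a module with endomorphism ring `k` is the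
whole module (`isIso_of_retract`), so every exceptional module is on the list; conversely all listed
modules are exceptional. Since `P_i` is projective and injective, positive Ext occurs only between
simples, and dimension shifting along `0 → S_{i+1} → P_i → S_i → 0` shows that `Ext^l(S_i, S_j)` is
nonzero for some `l ≥ 1` exactly when `i < j` (`ext_indec_iff`).

The problem becomes one of words of length `n` in these indices under three constraints: simples
occur in increasing order, `P_{i+1}` precedes `P_i`, and `S_i` lies after `P_i` and before
`P_{i-1}`. Join `i` and `i+1` whenever `P_i` occurs; this cuts the vertices into intervals, the
blocks. Two simples `S_a`, `S_b` with `a < b` in one block would give the cycle `S_b, P_{b-1}, …,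
P_a, S_a, S_b`, so a block contains at most one simple. A block of `m` vertices carries `m - 1`
length-two modules, so length `n` forces exactly one simple in each (`exists_vertex_mem`); its
vertex is the root.

Attach `S_v` to a root `v` and the first edge towards the root to any other vertex. The positions in
the word then number the vertices, increasingly on roots and decreasingly on each block: a
`BlockNumbering`. Transporting the root map to the numbers gives an idempotent function. Conversely,
an idempotent `f` determines the numbering by sorting the numbers `t` by `f t`, and decreasingly
within each fibre. Rooted forests of height at most one are idempotent functions through the map
sending a vertex to its root. -/

namespace Nakayama

open CategoryTheory

/-! ### Generators and relations -/

section Generators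

variable (k : Type u) [Field k] (n : ℕ)

/-- The image of a generator in the Nakayama algebra. -/
def gen (g : Gen n) : NakayamaAlgebra k n :=
  RingQuot.mkAlgHom k (Rel k n) (FreeAlgebra.ι k g)

variable {n}

lemma gen_vertex_mul_self (i : Fin n) :
    gen k n (.vertex i) * gen k n (.vertex i) = gen k n (.vertex i) := by
  simpa only [gen, map_mul] using RingQuot.mkAlgHom_rel k (Rel.vertex_idem (k := k) i)

lemma gen_vertex_mul_of_ne {i j : Fin n} (hij : i ≠ j) :
    gen k n (.vertex i) * gen k n (.vertex j) = 0 := by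
  simpa only [gen, map_mul, map_zero] using
    RingQuot.mkAlgHom_rel k (Rel.vertex_orth (k := k) i j hij)

lemma sum_gen_vertex : ∑ i : Fin n, gen k n (.vertex i) = 1 := by
  simpa only [gen, map_sum, map_one] using RingQuot.mkAlgHom_rel k (Rel.vertex_sum (k := k) (n := n))

lemma gen_arrow_mul_vertex (i j : Fin n) (h : (i : ℕ) + 1 = j) :
    gen k n (.arrow i j h) * gen k n (.vertex i) = gen k n (.arrow i j h) := by
  simpa only [gen, map_mul] using RingQuot.mkAlgHom_rel k (Rel.arrow_source (k := k) i j h)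

lemma gen_vertex_mul_arrow (i j : Fin n) (h : (i : ℕ) + 1 = j) :
    gen k n (.vertex j) * gen k n (.arrow i j h) = gen k n (.arrow i j h) := by
  simpa only [gen, map_mul] using RingQuot.mkAlgHom_rel k (Rel.arrow_target (k := k) i j h)

lemma gen_arrow_mul_vertex_of_ne {i j l : Fin n} (h : (i : ℕ) + 1 = j) (hl : i ≠ l) :
    gen k n (.arrow i j h) * gen k n (.vertex l) = 0 := by
  rw [← gen_arrow_mul_vertex, mul_assoc, gen_vertex_mul_of_ne k hl, mul_zero]

lemma gen_vertex_mul_arrow_of_ne {i j l : Fin n} (h : (i : ℕ) + 1 = j) (hl : l ≠ j) :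
    gen k n (.vertex l) * gen k n (.arrow i j h) = 0 := by
  rw [← gen_vertex_mul_arrow, ← mul_assoc, gen_vertex_mul_of_ne k hl, zero_mul]

lemma gen_arrow_mul_arrow (a b i j : Fin n) (h : (i : ℕ) + 1 = j) (h' : (a : ℕ) + 1 = b) :
    gen k n (.arrow a b h') * gen k n (.arrow i j h) = 0 := by
  by_cases hja : a = j
  · subst hja
    simpa only [gen, map_mul, map_zero] using
      RingQuot.mkAlgHom_rel k (Rel.rad_sq (k := k) i a b h h')
  · rw [← gen_arrow_mul_vertex, mul_assoc, gen_vertex_mul_arrow_of_ne k h hja, mul_zero]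

variable {k}

/-- Every element of a module is determined by its components at the vertices. -/
lemma eq_zero_of_vertex_smul {M : Type*} [AddCommGroup M] [Module (NakayamaAlgebra k n) M] {x : M}
    (hx : ∀ i, gen k n (.vertex i) • x = 0) : x = 0 := by
  rw [← one_smul (NakayamaAlgebra k n) x, ← sum_gen_vertex, Finset.sum_smul]
  exact Finset.sum_eq_zero fun i _ => hx i

lemma smul_comm_of_gen {M N : Type*} [AddCommGroup M] [Module k M] [Module (NakayamaAlgebra k n) M]
    [IsScalarTower k (NakayamaAlgebra k n) M] [AddCommGroup N] [Module k N]
    [Module (NakayamaAlgebra k n) N] [IsScalarTower k (NakayamaAlgebra k n) N] (f : M →ₗ[k] N)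
    (hf : ∀ g m, f (gen k n g • m) = gen k n g • f m) (a : NakayamaAlgebra k n) (m : M) :
    f (a • m) = a • f m := by
  obtain ⟨a, rfl⟩ := RingQuot.mkAlgHom_surjective k (Rel k n) a
  induction a using FreeAlgebra.induction generalizing m with
  | grade0 r => rw [AlgHom.commutes, algebraMap_smul, algebraMap_smul, map_smul]
  | grade1 g => exact hf g m
  | mul a b ha hb => rw [map_mul, mul_smul, mul_smul, ha, hb]
  | add a b ha hb => rw [map_add, add_smul, add_smul, map_add, ha, hb]

/-- A `k`-linear map which commutes with the generators is linear over the Nakayama algebra. -/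
def linearMapOfGen {M N : Type*} [AddCommGroup M] [Module k M] [Module (NakayamaAlgebra k n) M]
    [IsScalarTower k (NakayamaAlgebra k n) M] [AddCommGroup N] [Module k N]
    [Module (NakayamaAlgebra k n) N] [IsScalarTower k (NakayamaAlgebra k n) N] (f : M →ₗ[k] N)
    (hf : ∀ g m, f (gen k n g • m) = gen k n g • f m) : M →ₗ[NakayamaAlgebra k n] N where
  toFun := f
  map_add' := f.map_add
  map_smul' := smul_comm_of_gen f hf

end Generators

/-! ### Simple modules and modules of length two -/

section Modules

variable (k : Type u) [Field k] {n : ℕ}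

/-- The character of the Nakayama algebra at a vertex. -/
noncomputable def character (i : Fin n) : NakayamaAlgebra k n →ₐ[k] k :=
  RingQuot.liftAlgHom k ⟨FreeAlgebra.lift k fun
    | .vertex j => if j = i then 1 else 0
    | .arrow _ _ _ => 0, by
    intro x y hxy
    induction hxy with
    | vertex_idem j => by_cases h : j = i <;> simp [h]
    | vertex_orth j l h =>
      by_cases h1 : j = i <;> by_cases h2 : l = i <;> simp [h1, h2]
      exact h (h1.trans h2.symm)
    | vertex_sum => simp
    | arrow_source | arrow_target | rad_sq => simp⟩

/-- The action of a generator on the underlying space of the projective-injective module attached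
to the arrow `i ⟶ j`. -/
noncomputable def arrowAction (i j : Fin n) : Gen n → Module.End k (k × k)
  | .vertex l => if l = i then LinearMap.inl k k k ∘ₗ LinearMap.fst k k k
      else if l = j then LinearMap.inr k k k ∘ₗ LinearMap.snd k k k else 0
  | .arrow a _ _ => if a = i then LinearMap.inr k k k ∘ₗ LinearMap.fst k k k else 0

/-- The representation of the Nakayama algebra attached to the arrow `i ⟶ j`. -/
noncomputable def arrowRep (i j : Fin n) (h : (i : ℕ) + 1 = j) :
    NakayamaAlgebra k n →ₐ[k] Module.End k (k × k) :=
  RingQuot.liftAlgHom k ⟨FreeAlgebra.lift k (arrowAction k i j), by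
    have hij : i ≠ j := fun e => by subst e; omega
    intro x y hxy
    induction hxy with
    | vertex_idem l =>
      simp only [freeVertex, map_mul, FreeAlgebra.lift_ι_apply, arrowAction]
      split_ifs <;> ext <;> simp
    | vertex_orth l m h =>
      simp only [freeVertex, map_mul, FreeAlgebra.lift_ι_apply, arrowAction, map_zero]
      split_ifs <;> first | (exfalso; grind) | (ext <;> simp)
    | vertex_sum =>
      simp only [freeVertex, map_sum, FreeAlgebra.lift_ι_apply, arrowAction, map_one]
      -- As `i ≠ j`, the nested case distinction is a sum of two indicator terms, and the total is
      -- the sum of the two coordinate projections.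
      have : ∀ l : Fin n, (if l = i then LinearMap.inl k k k ∘ₗ LinearMap.fst k k k
          else if l = j then LinearMap.inr k k k ∘ₗ LinearMap.snd k k k else 0) =
          (if l = i then LinearMap.inl k k k ∘ₗ LinearMap.fst k k k else 0) +
          (if l = j then LinearMap.inr k k k ∘ₗ LinearMap.snd k k k else 0) := by
        intro l
        split_ifs <;> grind
      simp only [this, Finset.sum_add_distrib, Finset.sum_ite_eq', Finset.mem_univ, if_true]
      ext <;> simp
    | arrow_source a b hab =>
      simp only [freeVertex, freeArrow, map_mul, FreeAlgebra.lift_ι_apply, arrowAction]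
      split_ifs <;> first | (exfalso; grind) | (ext <;> simp)
    | arrow_target a b hab =>
      simp only [freeVertex, freeArrow, map_mul, FreeAlgebra.lift_ι_apply, arrowAction]
      -- The action of an arrow tests only its source; the target is then forced.
      have : a = i → b = j := fun e => by subst e; exact Fin.ext (by omega)
      split_ifs <;> first | (exfalso; grind) | (ext <;> simp)
    | rad_sq a b c hab hbc =>
      simp only [freeArrow, map_mul, FreeAlgebra.lift_ι_apply, arrowAction, map_zero]
      split_ifs <;> first | (exfalso; grind) | (ext <;> simp)⟩

lemma character_gen (i : Fin n) (g : Gen n) :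
    character k i (gen k n g) = match g with
      | .vertex j => if j = i then 1 else 0
      | .arrow _ _ _ => 0 := by
  rw [character, gen, RingQuot.liftAlgHom_mkAlgHom_apply, FreeAlgebra.lift_ι_apply]

lemma arrowRep_gen (i j : Fin n) (h : (i : ℕ) + 1 = j) (g : Gen n) :
    arrowRep k i j h (gen k n g) = arrowAction k i j g := by
  rw [arrowRep, gen, RingQuot.liftAlgHom_mkAlgHom_apply, FreeAlgebra.lift_ι_apply]

/-- The simple module at the vertex `i`. -/
@[nolint unusedArguments]
def SimpleModule (_ : Fin n) : Type u := k

/-- The indecomposable module of length two attached to the arrow `i ⟶ j`. -/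
@[nolint unusedArguments]
def ArrowModule (i j : Fin n) (_ : (i : ℕ) + 1 = j) : Type u := k × k

section Instances

variable (i j : Fin n) (h : (i : ℕ) + 1 = j)

noncomputable instance : AddCommGroup (SimpleModule k i) := inferInstanceAs (AddCommGroup k)
noncomputable instance : Module k (SimpleModule k i) := inferInstanceAs (Module k k)
noncomputable instance : Module (NakayamaAlgebra k n) (SimpleModule k i) :=
  Module.compHom k (character k i).toRingHom
noncomputable instance : AddCommGroup (ArrowModule k i j h) := inferInstanceAs (AddCommGroup (k × k))
noncomputable instance : Module k (ArrowModule k i j h) := inferInstanceAs (Module k (k × k))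
noncomputable instance : Module (NakayamaAlgebra k n) (ArrowModule k i j h) :=
  Module.compHom (k × k) (arrowRep k i j h).toRingHom

lemma SimpleModule.smul_def (a : NakayamaAlgebra k n) (x : SimpleModule k i) :
    a • x = character k i a • x := rfl

lemma ArrowModule.smul_def (a : NakayamaAlgebra k n) (x : ArrowModule k i j h) :
    a • x = (arrowRep k i j h a : Module.End k (k × k)) x := rfl

instance : IsScalarTower k (NakayamaAlgebra k n) (SimpleModule k i) :=
  ⟨fun c a x => by
    rw [SimpleModule.smul_def, SimpleModule.smul_def, map_smul, smul_assoc]⟩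

instance : IsScalarTower k (NakayamaAlgebra k n) (ArrowModule k i j h) :=
  ⟨fun c a x => by
    rw [ArrowModule.smul_def, ArrowModule.smul_def, map_smul]
    rfl⟩

instance : Module.Finite (NakayamaAlgebra k n) (SimpleModule k i) :=
  haveI : Module.Finite k (SimpleModule k i) := inferInstanceAs (Module.Finite k k)
  .of_restrictScalars_finite k _ _

instance : Module.Finite (NakayamaAlgebra k n) (ArrowModule k i j h) :=
  haveI : Module.Finite k (ArrowModule k i j h) := inferInstanceAs (Module.Finite k (k × k))
  .of_restrictScalars_finite k _ _

end Instances

end Modules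

end Nakayama

namespace Nakayama

open CategoryTheory

section Elements

variable (k : Type u) [Field k] {n : ℕ}

lemma SimpleModule.vertex_smul_self (i : Fin n) (x : SimpleModule k i) :
    gen k n (.vertex i) • x = x := by
  simp [smul_def, character_gen]

lemma SimpleModule.vertex_smul_of_ne {i j : Fin n} (hj : j ≠ i) (x : SimpleModule k i) :
    gen k n (.vertex j) • x = 0 := by
  simp [smul_def, character_gen, hj]

lemma SimpleModule.arrow_smul (i a b : Fin n) (h : (a : ℕ) + 1 = b) (x : SimpleModule k i) :
    gen k n (.arrow a b h) • x = 0 := by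
  simp [smul_def, character_gen]

/-- The coordinate of the simple module. -/
noncomputable def SimpleModule.coord (i : Fin n) : SimpleModule k i ≃ₗ[k] k := LinearEquiv.refl k k

/-- The generator of the simple module. -/
noncomputable def SimpleModule.one (i : Fin n) : SimpleModule k i := (1 : k)

lemma SimpleModule.coord_one (i : Fin n) : coord k i (one k i) = 1 := rfl

lemma SimpleModule.eq_smul_one (i : Fin n) (x : SimpleModule k i) :
    x = coord k i x • one k i := (mul_one (M := k) x).symm

lemma SimpleModule.one_ne_zero (i : Fin n) : one k i ≠ 0 := _root_.one_ne_zero (α := k)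

namespace ArrowModule

variable (i j : Fin n) (h : (i : ℕ) + 1 = j)

/-- The coordinate of the module of length two at its top. -/
noncomputable def top : ArrowModule k i j h →ₗ[k] k := LinearMap.fst k k k

/-- The coordinate of the module of length two at its socle. -/
noncomputable def soc : ArrowModule k i j h →ₗ[k] k := LinearMap.snd k k k

/-- The element of the module of length two with given coordinates. -/
noncomputable def mk : (k × k) ≃ₗ[k] ArrowModule k i j h := LinearEquiv.refl k (k × k)

@[simp] lemma top_mk (x : k × k) : top k i j h (mk k i j h x) = x.1 := rfl
@[simp] lemma soc_mk (x : k × k) : soc k i j h (mk k i j h x) = x.2 := rfl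

variable {k i j h} in
lemma ext {x y : ArrowModule k i j h} (h1 : top k i j h x = top k i j h y)
    (h2 : soc k i j h x = soc k i j h y) : x = y := Prod.ext h1 h2

lemma source_smul (x : ArrowModule k i j h) :
    gen k n (.vertex i) • x = mk k i j h (top k i j h x, 0) := by
  rw [smul_def, arrowRep_gen, arrowAction, if_pos rfl]
  rfl

lemma target_smul (x : ArrowModule k i j h) :
    gen k n (.vertex j) • x = mk k i j h (0, soc k i j h x) := by
  rw [smul_def, arrowRep_gen, arrowAction, if_neg (by rintro rfl; omega), if_pos rfl]
  rfl

lemma vertex_smul_of_ne {l : Fin n} (hi : l ≠ i) (hj : l ≠ j) (x : ArrowModule k i j h) :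
    gen k n (.vertex l) • x = 0 := by
  rw [smul_def, arrowRep_gen, arrowAction, if_neg hi, if_neg hj]
  rfl

lemma arrow_smul_self (x : ArrowModule k i j h) :
    gen k n (.arrow i j h) • x = mk k i j h (0, top k i j h x) := by
  rw [smul_def, arrowRep_gen, arrowAction, if_pos rfl]
  rfl

lemma arrow_smul_of_ne {a b : Fin n} (hab : (a : ℕ) + 1 = b) (ha : a ≠ i)
    (x : ArrowModule k i j h) : gen k n (.arrow a b hab) • x = 0 := by
  rw [smul_def, arrowRep_gen, arrowAction, if_neg ha]
  rfl

end ArrowModule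

end Elements

section Fixed

variable {k : Type u} [Field k] {n : ℕ} {M : Type*} [AddCommGroup M]
  [Module (NakayamaAlgebra k n) M]

lemma vertex_smul_of_fixed {i l : Fin n} {x : M} (hx : gen k n (.vertex i) • x = x) (hl : l ≠ i) :
    gen k n (.vertex l) • x = 0 := by
  rw [← hx, ← mul_smul, gen_vertex_mul_of_ne k hl, zero_smul]

lemma arrow_smul_of_fixed {i a b : Fin n} {x : M} (hx : gen k n (.vertex i) • x = x)
    (hab : (a : ℕ) + 1 = b) (ha : a ≠ i) : gen k n (.arrow a b hab) • x = 0 := by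
  rw [← hx, ← mul_smul, gen_arrow_mul_vertex_of_ne k hab ha, zero_smul]

end Fixed

/-! ### Maps between the indecomposables and arbitrary modules -/

section Maps

variable {k : Type u} [Field k] {n : ℕ} {M : Type*} [AddCommGroup M] [Module k M]
  [Module (NakayamaAlgebra k n) M] [IsScalarTower k (NakayamaAlgebra k n) M]

lemma gen_smul_smul (g : Gen n) (c : k) (x : M) : gen k n g • c • x = c • gen k n g • x := by
  rw [← algebraMap_smul (NakayamaAlgebra k n) c, ← algebraMap_smul (NakayamaAlgebra k n) c,
    ← mul_smul, ← mul_smul, Algebra.commutes]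

/-- The map from the simple module at `i` attached to an element at the vertex `i` which is killed
by the arrows. -/
noncomputable def SimpleModule.desc (i : Fin n) (x : M) (hx : gen k n (.vertex i) • x = x)
    (hx0 : ∀ a b h, gen k n (.arrow a b h) • x = 0) : SimpleModule k i →ₗ[NakayamaAlgebra k n] M :=
  linearMapOfGen (LinearMap.toSpanSingleton k M x ∘ₗ (coord k i).toLinearMap) (by
    rintro (l | ⟨a, b, h⟩) m
    · by_cases hl : l = i
      · subst hl
        simp [SimpleModule.vertex_smul_self, gen_smul_smul, hx]
      · simp [SimpleModule.vertex_smul_of_ne k hl, gen_smul_smul, vertex_smul_of_fixed hx hl]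
    · simp [SimpleModule.arrow_smul, gen_smul_smul, hx0])

lemma SimpleModule.desc_apply (i : Fin n) (x : M) (hx : gen k n (.vertex i) • x = x)
    (hx0 : ∀ a b h, gen k n (.arrow a b h) • x = 0) (m : SimpleModule k i) :
    desc i x hx hx0 m = coord k i m • x := rfl

/-- The map to the simple module at `i` attached to a functional, provided that the arrows act by
zero. -/
noncomputable def SimpleModule.lift (i : Fin n) (φ : M →ₗ[k] k)
    (hM : ∀ (x : M) a b h, gen k n (.arrow a b h) • x = 0) :
    M →ₗ[NakayamaAlgebra k n] SimpleModule k i :=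
  linearMapOfGen
    ((coord k i).symm.toLinearMap ∘ₗ φ ∘ₗ Algebra.lsmul k k M (gen k n (.vertex i))) (by
    rintro (l | ⟨a, b, h⟩) m
    · by_cases hl : l = i
      · subst hl
        simp [SimpleModule.vertex_smul_self, ← mul_smul, gen_vertex_mul_self]
      · simp [SimpleModule.vertex_smul_of_ne k hl, ← mul_smul, gen_vertex_mul_of_ne k (Ne.symm hl)]
    · simp [SimpleModule.arrow_smul, hM])

lemma SimpleModule.coord_lift_apply (i : Fin n) (φ : M →ₗ[k] k)
    (hM : ∀ (x : M) a b h, gen k n (.arrow a b h) • x = 0) (m : M) :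
    coord k i (lift i φ hM m) = φ (gen k n (.vertex i) • m) := rfl

namespace ArrowModule

variable (i j : Fin n) (h : (i : ℕ) + 1 = j)

/-- The map from the module of length two with top `i` attached to an element at the vertex `i`. -/
noncomputable def desc (x : M) (hx : gen k n (.vertex i) • x = x) :
    ArrowModule k i j h →ₗ[NakayamaAlgebra k n] M :=
  linearMapOfGen (LinearMap.toSpanSingleton k M x ∘ₗ top k i j h +
    LinearMap.toSpanSingleton k M (gen k n (.arrow i j h) • x) ∘ₗ soc k i j h) (by
    have hij : i ≠ j := by rintro rfl; omega
    have hx' : gen k n (.vertex j) • gen k n (.arrow i j h) • x = gen k n (.arrow i j h) • x := by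
      rw [← mul_smul, gen_vertex_mul_arrow]
    rintro (l | ⟨a, b, hab⟩) m
    · by_cases hl : l = i
      · subst hl
        simp [source_smul, gen_smul_smul, hx, vertex_smul_of_fixed hx' hij]
      · by_cases hl' : l = j
        · subst hl'
          simp [target_smul, gen_smul_smul, hx', vertex_smul_of_fixed hx hl]
        · simp [vertex_smul_of_ne k i j h hl hl', gen_smul_smul, vertex_smul_of_fixed hx' hl',
            vertex_smul_of_fixed hx hl]
    · by_cases ha : a = i
      · subst ha
        obtain rfl : b = j := Fin.ext (by omega)
        simp [arrow_smul_self, gen_smul_smul, ← mul_smul, gen_arrow_mul_arrow]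
      · simp [arrow_smul_of_ne k i j h hab ha, gen_smul_smul, arrow_smul_of_fixed hx hab ha,
          ← mul_smul, gen_arrow_mul_arrow])

lemma desc_apply (x : M) (hx : gen k n (.vertex i) • x = x) (m : ArrowModule k i j h) :
    desc i j h x hx m = top k i j h m • x + soc k i j h m • gen k n (.arrow i j h) • x := rfl

/-- The map to the module of length two with socle `j` attached to a functional. -/
noncomputable def lift (φ : M →ₗ[k] k) : M →ₗ[NakayamaAlgebra k n] ArrowModule k i j h :=
  linearMapOfGen ((mk k i j h).toLinearMap ∘ₗ
    LinearMap.prod (φ ∘ₗ Algebra.lsmul k k M (gen k n (.arrow i j h)))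
      (φ ∘ₗ Algebra.lsmul k k M (gen k n (.vertex j)))) (by
    have hij : i ≠ j := by rintro rfl; omega
    rintro (l | ⟨a, b, hab⟩) m
    · by_cases hl : l = i
      · subst hl
        apply ext <;>
        simp [source_smul, ← mul_smul, gen_arrow_mul_vertex, gen_vertex_mul_of_ne k (Ne.symm hij)]
      · by_cases hl' : l = j
        · subst hl'
          apply ext <;>
          simp [target_smul, ← mul_smul, gen_vertex_mul_self, gen_arrow_mul_vertex_of_ne k h hij]
        · apply ext <;>
          simp [vertex_smul_of_ne k i j h hl hl', ← mul_smul, gen_vertex_mul_of_ne k (Ne.symm hl'),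
            gen_arrow_mul_vertex_of_ne k h (Ne.symm hl)]
    · by_cases ha : a = i
      · subst ha
        obtain rfl : b = j := Fin.ext (by omega)
        apply ext <;>
        simp [arrow_smul_self, ← mul_smul, gen_arrow_mul_arrow, gen_vertex_mul_arrow]
      · have hb : j ≠ b := by rintro rfl; exact ha (Fin.ext (by omega))
        apply ext <;>
        simp [arrow_smul_of_ne k i j h hab ha, ← mul_smul, gen_arrow_mul_arrow,
          gen_vertex_mul_arrow_of_ne k hab hb])

lemma top_lift_apply (φ : M →ₗ[k] k) (m : M) :
    top k i j h (lift i j h φ m) = φ (gen k n (.arrow i j h) • m) := rfl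

lemma soc_lift_apply (φ : M →ₗ[k] k) (m : M) :
    soc k i j h (lift i j h φ m) = φ (gen k n (.vertex j) • m) := rfl

end ArrowModule

end Maps

end Nakayama

namespace Nakayama

open CategoryTheory

section Generation

variable {k : Type u} [Field k] {n : ℕ} {M : Type*} [AddCommGroup M]
  [Module (NakayamaAlgebra k n) M]

lemma SimpleModule.hom_ext {i : Fin n} {f f' : SimpleModule k i →ₗ[NakayamaAlgebra k n] M}
    (hf : f (one k i) = f' (one k i)) : f = f' := by
  ext x
  rw [eq_smul_one k i x, ← algebraMap_smul (NakayamaAlgebra k n), map_smul, map_smul, hf]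

lemma SimpleModule.vertex_smul_map_one {i : Fin n}
    (f : SimpleModule k i →ₗ[NakayamaAlgebra k n] M) :
    gen k n (.vertex i) • f (one k i) = f (one k i) := by
  rw [← map_smul, vertex_smul_self]

lemma SimpleModule.arrow_smul_map {i a b : Fin n} (h : (a : ℕ) + 1 = b)
    (f : SimpleModule k i →ₗ[NakayamaAlgebra k n] M) (x : SimpleModule k i) :
    gen k n (.arrow a b h) • f x = 0 := by
  rw [← map_smul, arrow_smul, map_zero]

namespace ArrowModule

variable {i j : Fin n} {h : (i : ℕ) + 1 = j}

variable (k i j h) in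
/-- The generator of the module of length two. -/
noncomputable def one : ArrowModule k i j h := mk k i j h (1, 0)

@[simp] lemma top_one : top k i j h (one k i j h) = 1 := rfl
@[simp] lemma soc_one : soc k i j h (one k i j h) = 0 := rfl

/-- The module is cyclic: the arrow carries the generator at the top to the socle. Hence a map out
of it is determined by the image of the generator. -/
lemma eq_smul_one (x : ArrowModule k i j h) :
    x = (algebraMap k (NakayamaAlgebra k n) (top k i j h x) +
      algebraMap k (NakayamaAlgebra k n) (soc k i j h x) * gen k n (.arrow i j h)) •
        one k i j h := by
  rw [add_smul, mul_smul, algebraMap_smul, algebraMap_smul]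
  apply ext <;> simp [arrow_smul_self]

lemma hom_ext {f f' : ArrowModule k i j h →ₗ[NakayamaAlgebra k n] M}
    (hf : f (one k i j h) = f' (one k i j h)) : f = f' := by
  ext x
  rw [eq_smul_one x, map_smul, map_smul, hf]

lemma vertex_smul_map_one (f : ArrowModule k i j h →ₗ[NakayamaAlgebra k n] M) :
    gen k n (.vertex i) • f (one k i j h) = f (one k i j h) := by
  rw [← map_smul, source_smul]
  rfl

end ArrowModule

end Generation

section Components

variable {k : Type u} [Field k] {n : ℕ}

lemma SimpleModule.eq_zero_of_fixed {i l : Fin n} {x : SimpleModule k i}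
    (hx : gen k n (.vertex l) • x = x) (hl : l ≠ i) : x = 0 := by
  rw [← hx, vertex_smul_of_ne k hl]

namespace ArrowModule

variable {i j : Fin n} {h : (i : ℕ) + 1 = j}

lemma eq_zero_of_fixed {l : Fin n} {x : ArrowModule k i j h}
    (hx : gen k n (.vertex l) • x = x) (hi : l ≠ i) (hj : l ≠ j) : x = 0 := by
  rw [← hx, vertex_smul_of_ne k i j h hi hj]

lemma soc_eq_zero_of_fixed {x : ArrowModule k i j h} (hx : gen k n (.vertex i) • x = x) :
    soc k i j h x = 0 := by
  rw [← hx, source_smul, soc_mk]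

lemma top_eq_zero_of_arrow_smul {x : ArrowModule k i j h}
    (hx : gen k n (.arrow i j h) • x = 0) : top k i j h x = 0 := by
  have := congrArg (soc k i j h) hx
  rwa [arrow_smul_self, soc_mk, map_zero] at this

end ArrowModule

end Components

/-! ### Homomorphisms between the indecomposables -/

section Homs

variable (k : Type u) [Field k] {n : ℕ}

/-- The indecomposable modules over the Nakayama algebra. -/
noncomputable def indec : Gen n → ModuleCat.{u} (NakayamaAlgebra k n)
  | .vertex i => ModuleCat.of _ (SimpleModule k i)
  | .arrow i j h => ModuleCat.of _ (ArrowModule k i j h)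

/-- Whether there is a nonzero map between the indecomposable modules with given indices. -/
def HomNonzero : Gen n → Gen n → Prop
  | .vertex i, .vertex j => i = j
  | .vertex i, .arrow _ b _ => i = b
  | .arrow i _ _, .vertex j => i = j
  | .arrow i _ _, .arrow a b _ => i = a ∨ i = b

/-- A map is determined by the image of the generator, which lies in the component of the target at
the vertex of the generator and, for a simple source, is killed by all arrows. Outside the listed
cases no nonzero such element exists. -/
lemma subsingleton_hom_indec {g h : Gen n} (hgh : ¬ HomNonzero g h) :
    Subsingleton (indec k g ⟶ indec k h) := by
  refine subsingleton_of_forall_eq 0 fun f => ModuleCat.hom_ext ?_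
  rcases g with i | ⟨i, j, hij⟩ <;> rcases h with a | ⟨a, b, hab⟩
  · exact SimpleModule.hom_ext
      (SimpleModule.eq_zero_of_fixed (k := k) (i := a) (SimpleModule.vertex_smul_map_one f.hom) hgh)
  · refine SimpleModule.hom_ext ?_
    change f.hom (SimpleModule.one k i) = 0
    by_cases hia : i = a
    · subst hia
      exact ArrowModule.ext
        (ArrowModule.top_eq_zero_of_arrow_smul (SimpleModule.arrow_smul_map hab f.hom _))
        (ArrowModule.soc_eq_zero_of_fixed (SimpleModule.vertex_smul_map_one f.hom))
    · exact ArrowModule.eq_zero_of_fixed (SimpleModule.vertex_smul_map_one f.hom) hia hgh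
  · exact ArrowModule.hom_ext
      (SimpleModule.eq_zero_of_fixed (k := k) (i := a) (ArrowModule.vertex_smul_map_one f.hom) hgh)
  · exact ArrowModule.hom_ext (ArrowModule.eq_zero_of_fixed
      (ArrowModule.vertex_smul_map_one f.hom) (fun e => hgh (.inl e)) (fun e => hgh (.inr e)))

lemma not_subsingleton_indec (g : Gen n) : ¬ Subsingleton (indec k g) := by
  intro hs
  rcases g with i | ⟨i, j, hij⟩
  · exact SimpleModule.one_ne_zero k i (hs.elim _ _)
  · have : ArrowModule.one k i j hij = 0 := hs.elim _ _
    simpa using congrArg (ArrowModule.top k i j hij) this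

/-- The inclusion of the socle of the module of length two. -/
noncomputable def socleInclusion (i j : Fin n) (h : (i : ℕ) + 1 = j) :
    SimpleModule k j →ₗ[NakayamaAlgebra k n] ArrowModule k i j h :=
  SimpleModule.desc j (ArrowModule.mk k i j h (0, 1))
    (by rw [ArrowModule.target_smul, ArrowModule.soc_mk])
    (fun a b hab => by
      by_cases ha : a = i
      · subst ha
        obtain rfl : b = j := Fin.ext (by omega)
        rw [ArrowModule.arrow_smul_self, ArrowModule.top_mk, Prod.mk_zero_zero, map_zero]
      · rw [ArrowModule.arrow_smul_of_ne k i j h hab ha])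

/-- The projection of the module of length two to its top. -/
noncomputable def topProjection (i j : Fin n) (h : (i : ℕ) + 1 = j) :
    ArrowModule k i j h →ₗ[NakayamaAlgebra k n] SimpleModule k i :=
  ArrowModule.desc i j h (SimpleModule.one k i) (SimpleModule.vertex_smul_self k i _)

lemma socleInclusion_apply (i j : Fin n) (h : (i : ℕ) + 1 = j) (x : SimpleModule k j) :
    socleInclusion k i j h x = ArrowModule.mk k i j h (0, SimpleModule.coord k j x) := by
  rw [socleInclusion, SimpleModule.desc_apply, ← map_smul, Prod.smul_mk, smul_zero, smul_eq_mul,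
    mul_one]

lemma coord_topProjection (i j : Fin n) (h : (i : ℕ) + 1 = j) (x : ArrowModule k i j h) :
    SimpleModule.coord k i (topProjection k i j h x) = ArrowModule.top k i j h x := by
  rw [topProjection, ArrowModule.desc_apply, SimpleModule.arrow_smul, smul_zero, add_zero,
    map_smul, SimpleModule.coord_one, smul_eq_mul, mul_one]

/-- The witnesses are the identity, the inclusion of the socle, the projection to the top, and the
map from one length-two module through its top to the socle of another. -/
lemma not_subsingleton_hom_indec {g h : Gen n} (hgh : HomNonzero g h) :
    ¬ Subsingleton (indec k g ⟶ indec k h) := by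
  by_cases e : g = h
  · subst e
    intro hs
    refine not_subsingleton_indec k g ?_
    rw [← ModuleCat.isZero_iff_subsingleton, Limits.IsZero.iff_id_eq_zero]
    exact hs.elim _ _
  · intro hs
    rcases g with i | ⟨i, j, hij⟩ <;> rcases h with a | ⟨a, b, hab⟩
    · exact e (congrArg Gen.vertex hgh)
    · obtain rfl : i = b := hgh
      have : ModuleCat.ofHom (socleInclusion k a i hab) = 0 := hs.elim _ _
      have := congrArg (fun f => ArrowModule.soc k a i hab (f.hom (SimpleModule.one k i))) this
      simp [socleInclusion_apply, SimpleModule.coord_one] at this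
    · obtain rfl : i = a := hgh
      have : ModuleCat.ofHom (topProjection k i j hij) = 0 := hs.elim _ _
      have := congrArg
        (fun f => SimpleModule.coord k i (f.hom (ArrowModule.one k i j hij))) this
      simp [coord_topProjection] at this
    · rcases hgh with rfl | rfl
      · obtain rfl : j = b := Fin.ext (by omega)
        exact e rfl
      · have : ModuleCat.ofHom (ArrowModule.desc (k := k) i j hij
          (ArrowModule.mk k a i hab (0, 1))
          (by rw [ArrowModule.target_smul, ArrowModule.soc_mk])) = 0 := hs.elim _ _
        have := congrArg
          (fun f => ArrowModule.soc k a i hab (f.hom (ArrowModule.one k i j hij))) this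
        simp [ArrowModule.desc_apply] at this

/-- The component of an indecomposable at the vertex of its generator is a line, so an endomorphism
multiplies the generator by a scalar. -/
lemma exists_eq_smul_id (g : Gen n) (f : indec k g ⟶ indec k g) : ∃ c : k, f = c • 𝟙 _ := by
  rcases g with i | ⟨i, j, hij⟩
  · refine ⟨SimpleModule.coord k i (f.hom (SimpleModule.one k i)), ModuleCat.hom_ext
      (SimpleModule.hom_ext ?_)⟩
    refine (SimpleModule.eq_smul_one k i (f.hom (SimpleModule.one k i))).trans ?_
    exact (algebraMap_smul (NakayamaAlgebra k n) _ (SimpleModule.one k i)).symm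
  · let f' : ArrowModule k i j hij →ₗ[NakayamaAlgebra k n] ArrowModule k i j hij := f.hom
    refine ⟨ArrowModule.top k i j hij (f' (ArrowModule.one k i j hij)), ModuleCat.hom_ext
      (ArrowModule.hom_ext ?_)⟩
    change f' (ArrowModule.one k i j hij) = algebraMap k (NakayamaAlgebra k n)
      (ArrowModule.top k i j hij (f' (ArrowModule.one k i j hij))) • ArrowModule.one k i j hij
    nth_rewrite 1 [ArrowModule.eq_smul_one (f' (ArrowModule.one k i j hij))]
    rw [ArrowModule.soc_eq_zero_of_fixed (ArrowModule.vertex_smul_map_one f'), map_zero,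
      zero_mul, add_zero]

/-- The indices of mutually isomorphic indecomposable modules agree. -/
lemma eq_of_indec_iso {g h : Gen n} (e : indec k g ≅ indec k h) : g = h := by
  have h1 : HomNonzero g h := by
    by_contra hn
    have := subsingleton_hom_indec k hn
    apply not_subsingleton_indec k g
    rw [← ModuleCat.isZero_iff_subsingleton, Limits.IsZero.iff_id_eq_zero, ← e.hom_inv_id,
      Subsingleton.elim e.hom 0, Limits.zero_comp]
  have h2 : HomNonzero h g := by
    by_contra hn
    have := subsingleton_hom_indec k hn
    apply not_subsingleton_indec k g
    rw [← ModuleCat.isZero_iff_subsingleton, Limits.IsZero.iff_id_eq_zero, ← e.hom_inv_id,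
      Subsingleton.elim e.inv 0, Limits.comp_zero]
  -- Nonzero maps in both directions exist only for equal indices.
  rcases g with i | ⟨i, j, hij⟩ <;> rcases h with a | ⟨a, b, hab⟩ <;>
    simp only [HomNonzero, Gen.vertex.injEq, Gen.arrow.injEq] at * <;> grind

end Homs

/-! ### Objects whose endomorphisms are scalars -/

section Linear

variable {k : Type u} [Field k] {C : Type*} [Category C] [Preadditive C] [Linear k C] {X : C}

/-- If all endomorphisms of a nonzero object are scalars, then its endomorphism ring is the base
field. -/
lemma nonempty_end_linearEquiv (h0 : 𝟙 X ≠ 0) (hX : ∀ f : X ⟶ X, ∃ c : k, f = c • 𝟙 X) :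
    Nonempty ((X ⟶ X) ≃ₗ[k] k) :=
  ⟨(LinearEquiv.ofBijective (LinearMap.toSpanSingleton k (X ⟶ X) (𝟙 X))
    ⟨smul_left_injective k h0, fun f => (hX f).imp fun _ hc => hc.symm⟩).symm⟩

/-- An object all of whose endomorphisms are scalars is indecomposable. -/
lemma indecomposable_of_end_scalar [Limits.HasZeroObject C] [Limits.HasBinaryBiproducts C]
    (h0 : ¬ Limits.IsZero X) (hX : ∀ f : X ⟶ X, ∃ c : k, f = c • 𝟙 X) : Indecomposable X := by
  refine ⟨h0, fun Y Z e => ?_⟩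
  -- The idempotent projecting onto `Y` is a scalar `c`: if `c = 0` then `Y` vanishes, otherwise `Z`
  -- does.
  obtain ⟨c, hc⟩ := hX (e.hom ≫ Limits.biprod.fst ≫ Limits.biprod.inl ≫ e.inv)
  rw [Limits.IsZero.iff_id_eq_zero, Limits.IsZero.iff_id_eq_zero]
  by_cases hc0 : c = 0
  · left
    rw [hc0, zero_smul] at hc
    have := congrArg (fun f => Limits.biprod.inl ≫ e.inv ≫ f ≫ e.hom ≫ Limits.biprod.fst) hc
    simpa using this
  · right
    have := congrArg (fun f => Limits.biprod.inr ≫ e.inv ≫ f ≫ e.hom ≫ Limits.biprod.snd) hc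
    simpa [hc0] using this.symm

/-- A nonzero retract of an object whose endomorphism ring is the base field is the whole object. -/
lemma isIso_of_retract {Y : C} (hY : 𝟙 Y ≠ 0) (hX : Nonempty ((X ⟶ X) ≃ₗ[k] k))
    (s : Y ⟶ X) (r : X ⟶ Y) (hsr : s ≫ r = 𝟙 Y) : Nonempty (X ≅ Y) := by
  obtain ⟨φ⟩ := hX
  -- The endomorphism `r ≫ s` is a nonzero idempotent in a one-dimensional algebra, hence the
  -- identity.
  have he : r ≫ s ≠ 0 := fun h => hY (by
    rw [← hsr, ← Category.comp_id r, ← Category.assoc, ← Category.id_comp (𝟙 Y), ← hsr]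
    simp [reassoc_of% h])
  have hid : 𝟙 X ≠ 0 := fun h => he (by rw [← Category.id_comp r, h]; simp)
  have hφ : φ (𝟙 X) ≠ 0 := fun h => hid (φ.map_eq_zero_iff.1 h)
  obtain ⟨c, hc⟩ : ∃ c : k, r ≫ s = c • 𝟙 X := ⟨φ (r ≫ s) / φ (𝟙 X), φ.injective (by
    rw [map_smul, smul_eq_mul, div_mul_cancel₀ _ hφ])⟩
  have hcc : (r ≫ s) ≫ (r ≫ s) = r ≫ s := by
    rw [Category.assoc, ← Category.assoc s r, hsr, Category.id_comp]
  have hc1 : c • (r ≫ s) = (1 : k) • (r ≫ s) := by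
    rw [one_smul]
    nth_rewrite 2 [← hcc]
    nth_rewrite 2 [hc]
    rw [Linear.smul_comp, Category.id_comp]
  exact ⟨⟨r, s, by rw [hc, smul_left_injective k he hc1, one_smul], hsr⟩⟩

end Linear

end Nakayama

namespace Nakayama

open CategoryTheory

/-! ### Projectivity, injectivity and extensions -/

section Ext

variable (k : Type u) [Field k] {n : ℕ}

/-- Maps out of this module correspond to elements fixed by the idempotent at `i`; any preimage of
such an element can be corrected by applying that idempotent. -/
instance projective_arrow (i j : Fin n) (h : (i : ℕ) + 1 = j) :
    Projective (indec k (.arrow i j h)) where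
  factors {E X} f e he := by
    obtain ⟨y, hy⟩ := (ModuleCat.epi_iff_surjective e).1 he (f.hom (ArrowModule.one k i j h))
    let _ := ModuleCat.moduleOfAlgebraModule (k := k) E
    have := ModuleCat.isScalarTower_of_algebra_moduleCat (k := k) E
    have hfix := ArrowModule.vertex_smul_map_one (h := h) f.hom
    have hfix' : gen k n (.vertex i) • gen k n (.vertex i) • y = gen k n (.vertex i) • y := by
      rw [← mul_smul, gen_vertex_mul_self]
    refine ⟨ModuleCat.ofHom (ArrowModule.desc i j h _ hfix'),
      ModuleCat.hom_ext (ArrowModule.hom_ext ?_)⟩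
    change e.hom (ArrowModule.desc i j h _ hfix' (ArrowModule.one k i j h)) = _
    rw [ArrowModule.desc_apply, ArrowModule.top_one, ArrowModule.soc_one, one_smul, zero_smul,
      add_zero, map_smul, hy]
    exact hfix

/-- No arrow starts at the last vertex, so the argument for length-two modules applies: the
condition of being killed by arrows is automatic. -/
lemma projective_last (i : Fin n) (hi : (i : ℕ) + 1 = n) : Projective (indec k (.vertex i)) where
  factors {E X} f e he := by
    obtain ⟨y, hy⟩ := (ModuleCat.epi_iff_surjective e).1 he (f.hom (SimpleModule.one k i))
    let _ := ModuleCat.moduleOfAlgebraModule (k := k) E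
    have := ModuleCat.isScalarTower_of_algebra_moduleCat (k := k) E
    have hfix := SimpleModule.vertex_smul_map_one (i := i) f.hom
    have hfix' : gen k n (.vertex i) • gen k n (.vertex i) • y = gen k n (.vertex i) • y := by
      rw [← mul_smul, gen_vertex_mul_self]
    have hfix0 : ∀ a b h, gen k n (.arrow a b h) • gen k n (.vertex i) • y = 0 :=
      fun a b h => arrow_smul_of_fixed hfix' h (by rintro rfl; omega)
    refine ⟨ModuleCat.ofHom (SimpleModule.desc i _ hfix' hfix0),
      ModuleCat.hom_ext (SimpleModule.hom_ext ?_)⟩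
    change e.hom (SimpleModule.desc i _ hfix' hfix0 (SimpleModule.one k i)) = _
    rw [SimpleModule.desc_apply, SimpleModule.coord_one, one_smul, map_smul, hy]
    exact hfix

/-- A map into this module is determined by its socle coordinate, a `k`-linear functional, and
functionals extend along injections of vector spaces. -/
instance injective_arrow (i j : Fin n) (h : (i : ℕ) + 1 = j) :
    Injective (indec k (.arrow i j h)) where
  factors {X Y} g f hf := by
    let _ := ModuleCat.moduleOfAlgebraModule (k := k) X
    have := ModuleCat.isScalarTower_of_algebra_moduleCat (k := k) X
    let _ := ModuleCat.moduleOfAlgebraModule (k := k) Y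
    have := ModuleCat.isScalarTower_of_algebra_moduleCat (k := k) Y
    obtain ⟨ρ, hρ⟩ := (f.hom.restrictScalars k).exists_leftInverse_of_injective
      (LinearMap.ker_eq_bot.2 ((ModuleCat.mono_iff_injective f).1 hf))
    have hρ' : ∀ x, ρ (f.hom x) = x := fun x => LinearMap.congr_fun hρ x
    let g' : X →ₗ[NakayamaAlgebra k n] ArrowModule k i j h := g.hom
    let φ : X →ₗ[k] k := ArrowModule.soc k i j h ∘ₗ g'.restrictScalars k
    refine ⟨ModuleCat.ofHom (ArrowModule.lift i j h (φ ∘ₗ ρ)),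
      ModuleCat.hom_ext (LinearMap.ext fun x => ?_)⟩
    change ArrowModule.lift i j h (φ ∘ₗ ρ) (f.hom x) = g' x
    apply ArrowModule.ext
    · rw [ArrowModule.top_lift_apply, ← map_smul, LinearMap.comp_apply, hρ']
      change ArrowModule.soc k i j h (g' _) = _
      rw [map_smul, ArrowModule.arrow_smul_self, ArrowModule.soc_mk]
    · rw [ArrowModule.soc_lift_apply, ← map_smul, LinearMap.comp_apply, hρ']
      change ArrowModule.soc k i j h (g' _) = _
      rw [map_smul, ArrowModule.target_smul, ArrowModule.soc_mk]

/-- The presentation of a simple module by the module of length two. -/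
noncomputable def topSequence (i j : Fin n) (h : (i : ℕ) + 1 = j) :
    ShortComplex (ModuleCat.{u} (NakayamaAlgebra k n)) where
  X₁ := indec k (.vertex j)
  X₂ := indec k (.arrow i j h)
  X₃ := indec k (.vertex i)
  f := ModuleCat.ofHom (socleInclusion k i j h)
  g := ModuleCat.ofHom (topProjection k i j h)
  zero := ModuleCat.hom_ext (LinearMap.ext fun (x : SimpleModule k j) => by
    apply (SimpleModule.coord k i).injective
    change SimpleModule.coord k i (topProjection k i j h (socleInclusion k i j h x)) = _
    rw [coord_topProjection, socleInclusion_apply, ArrowModule.top_mk]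
    exact (map_zero _).symm)

lemma shortExact_topSequence (i j : Fin n) (h : (i : ℕ) + 1 = j) :
    (topSequence k i j h).ShortExact := by
  refine .mk' ?_ ?_ ?_
  · rw [ShortComplex.moduleCat_exact_iff]
    intro (x : ArrowModule k i j h) (hx : topProjection k i j h x = 0)
    refine ⟨(SimpleModule.coord k j).symm (ArrowModule.soc k i j h x), ?_⟩
    change socleInclusion k i j h ((SimpleModule.coord k j).symm (ArrowModule.soc k i j h x)) = x
    rw [socleInclusion_apply, LinearEquiv.apply_symm_apply]
    apply ArrowModule.ext
    · rw [ArrowModule.top_mk, ← coord_topProjection, hx, map_zero]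
    · rw [ArrowModule.soc_mk]
  · rw [ModuleCat.mono_iff_injective]
    intro (x : SimpleModule k j) (y : SimpleModule k j)
      (hxy : socleInclusion k i j h x = socleInclusion k i j h y)
    rw [socleInclusion_apply, socleInclusion_apply] at hxy
    exact (SimpleModule.coord k j).injective (congrArg (ArrowModule.soc k i j h) hxy)
  · rw [ModuleCat.epi_iff_surjective]
    intro (x : SimpleModule k i)
    refine ⟨ArrowModule.mk k i j h (SimpleModule.coord k i x, 0),
      (SimpleModule.coord k i).injective ?_⟩
    exact coord_topProjection k i j h _

/-- Dimension shifting replaces `i` by `i + 1` and lowers the degree by one, ending at Hom between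
distinct simples or at the projective simple of the last vertex. After one shift the case `j = i`
becomes `j < i + 1`. -/
lemma subsingleton_ext_vertex (l : ℕ) (i j : Fin n) (hij : j < i ∨ j = i ∧ 1 ≤ l) :
    Subsingleton (Abelian.Ext (indec k (.vertex i)) (indec k (.vertex j)) l) := by
  induction l generalizing i with
  | zero =>
    have := subsingleton_hom_indec k (g := .vertex i) (h := .vertex j)
      (by simp only [HomNonzero]; grind)
    exact Abelian.Ext.homEquiv₀.subsingleton
  | succ l ih =>
    by_cases hi : (i : ℕ) + 1 = n
    · have := projective_last k i hi
      exact Abelian.Ext.subsingleton_of_projective _ _ _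
    · let i' : Fin n := ⟨i + 1, by omega⟩
      have hii' : (i : ℕ) + 1 = i' := rfl
      have hlt : j < i' := by
        rw [Fin.lt_def, ← hii']
        grind
      have := ih i' (.inl hlt)
      have hS := shortExact_topSequence k i i' hii'
      refine subsingleton_of_forall_eq 0 fun x => ?_
      obtain ⟨x₁, rfl⟩ := Abelian.Ext.contravariant_sequence_exact₃ hS _ x
        ((Abelian.Ext.subsingleton_of_projective (indec k (.arrow i i' hii')) _ _).elim _ _)
        (Nat.add_comm 1 l)
      rw [show x₁ = 0 from this.elim _ _, Abelian.Ext.comp_zero]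
      rfl

/-- The connecting map from `Ext^l(S_{i+1}, S_j)` to `Ext^{l+1}(S_i, S_j)` is injective, so
nonvanishing propagates from `Hom(S_j, S_j)`. -/
lemma not_subsingleton_ext_vertex (l : ℕ) (i j : Fin n) (hij : (i : ℕ) + l = j) :
    ¬ Subsingleton (Abelian.Ext (indec k (.vertex i)) (indec k (.vertex j)) l) := by
  induction l generalizing i with
  | zero =>
    obtain rfl : i = j := Fin.ext hij
    intro hs
    exact not_subsingleton_hom_indec k (g := .vertex i) (h := .vertex i) rfl
      Abelian.Ext.homEquiv₀.symm.subsingleton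
  | succ l ih =>
    let i' : Fin n := ⟨i + 1, by omega⟩
    have hii' : (i : ℕ) + 1 = i' := rfl
    have hS := shortExact_topSequence k i i' hii'
    intro hs
    refine ih i' (by omega) (subsingleton_of_forall_eq 0 fun x => ?_)
    obtain ⟨y, rfl⟩ := Abelian.Ext.contravariant_sequence_exact₁ hS _ x (Nat.add_comm 1 l)
      (hs.elim _ _)
    cases l with
    | zero =>
      obtain ⟨φ, rfl⟩ := Abelian.Ext.homEquiv₀.symm.surjective y
      -- In degree zero the middle term need not vanish, but a map to a simple kills the socle,
      -- which is the image of the arrow.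
      have hφ : (topSequence k i i' hii').f ≫ φ = 0 := by
        refine ModuleCat.hom_ext (SimpleModule.hom_ext ?_)
        change φ.hom (socleInclusion k i i' hii' (SimpleModule.one k i')) = 0
        have : socleInclusion k i i' hii' (SimpleModule.one k i') =
            gen k n (.arrow i i' hii') • ArrowModule.one k i i' hii' := by
          rw [socleInclusion_apply, ArrowModule.arrow_smul_self]
          rfl
        rw [this]
        exact (map_smul φ.hom _ _).trans (SimpleModule.arrow_smul k j i i' hii' _)
      exact (Abelian.Ext.mk₀_comp_mk₀ _ _).trans
        ((congrArg Abelian.Ext.mk₀ hφ).trans (Abelian.Ext.mk₀_zero _ _))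
    | succ l =>
      rw [show y = 0 from
        (Abelian.Ext.subsingleton_of_projective (indec k (.arrow i i' hii')) _ _).elim _ _,
        Abelian.Ext.comp_zero]
      rfl

/-- Whether there is a nonzero extension in positive degree between the indecomposable modules with
given indices. -/
def ExtNonzero : Gen n → Gen n → Prop
  | .vertex i, .vertex j => i < j
  | _, _ => False

lemma ext_indec_iff (g h : Gen n) :
    (∀ l : ℕ, 1 ≤ l → Subsingleton (Abelian.Ext (indec k g) (indec k h) l)) ↔
      ¬ ExtNonzero g h := by
  rcases g with i | ⟨i, j, hij⟩
  · rcases h with a | ⟨a, b, hab⟩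
    · constructor
      · intro H (hia : i < a)
        -- The nonzero extension group sits in degree `a - i`.
        exact not_subsingleton_ext_vertex k (a - i) i a (by omega) (H _ (by omega))
      · intro (H : ¬ i < a) l hl
        exact subsingleton_ext_vertex k l i a (by omega)
    · refine iff_of_true (fun l hl => ?_) id
      obtain ⟨l, rfl⟩ := Nat.exists_eq_add_of_le' hl
      exact Abelian.Ext.subsingleton_of_injective _ _ _
  · refine iff_of_true (fun l hl => ?_) id
    obtain ⟨l, rfl⟩ := Nat.exists_eq_add_of_le' hl
    exact Abelian.Ext.subsingleton_of_projective _ _ _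

lemma isExceptional_indec (g : Gen n) : IsExceptional k (indec k g) where
  finite := by
    rcases g with i | ⟨i, j, h⟩
    · exact inferInstanceAs (Module.Finite _ (SimpleModule k i))
    · exact inferInstanceAs (Module.Finite _ (ArrowModule k i j h))
  indecomposable := indecomposable_of_end_scalar (k := k)
    (fun h => not_subsingleton_indec k g (ModuleCat.isZero_iff_subsingleton.1 h))
    (exists_eq_smul_id k g)
  end_equiv := nonempty_end_linearEquiv
    (fun h => not_subsingleton_indec k g (ModuleCat.isZero_iff_subsingleton.1
      ((Limits.IsZero.iff_id_eq_zero _).2 h))) (exists_eq_smul_id k g)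
  ext_eq_zero := (ext_indec_iff k g g).2 (by
    rcases g with i | ⟨i, j, h⟩
    · exact lt_irrefl i
    · exact id)

/-- Whether the indecomposable modules with given indices form an exceptional pair. -/
def Before (g h : Gen n) : Prop := ¬ HomNonzero h g ∧ ¬ ExtNonzero h g

lemma isExceptionalPair_indec_iff (g h : Gen n) :
    IsExceptionalPair k (indec k g) (indec k h) ↔ Before g h :=
  ⟨fun H => ⟨fun hn => not_subsingleton_hom_indec k hn H.hom_eq_zero,
    (ext_indec_iff k h g).1 H.ext_eq_zero⟩,
  fun H => ⟨isExceptional_indec k g, isExceptional_indec k h, subsingleton_hom_indec k H.1,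
    (ext_indec_iff k h g).2 H.2⟩⟩

end Ext

/-! ### Classification of exceptional modules -/

section Classification

variable {k : Type u} [Field k] {n : ℕ}

/-- Every nonzero module over the Nakayama algebra has an indecomposable direct summand. -/
lemma exists_indec_retract (M : ModuleCat.{u} (NakayamaAlgebra k n)) (hM : ¬ Subsingleton M) :
    ∃ (g : Gen n) (s : indec k g ⟶ M) (r : M ⟶ indec k g), s ≫ r = 𝟙 _ := by
  let _ := ModuleCat.moduleOfAlgebraModule (k := k) M
  have := ModuleCat.isScalarTower_of_algebra_moduleCat (k := k) M
  -- If all arrows act by zero, a simple splits off. Otherwise some arrow satisfies `α x ≠ 0`, and a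
  -- functional equal to `1` on `α x` splits off a length-two module.
  by_cases h0 : ∀ (x : M) a b h, gen k n (.arrow a b h) • x = 0
  · obtain ⟨i, x, hx⟩ : ∃ (i : Fin n) (x : M), gen k n (.vertex i) • x ≠ 0 := by
      by_contra! H
      exact hM (subsingleton_of_forall_eq 0 fun x => eq_zero_of_vertex_smul fun i => H i x)
    obtain ⟨φ, hφ⟩ := Module.Projective.exists_dual_eq_one k hx
    have hfix : gen k n (.vertex i) • gen k n (.vertex i) • x = gen k n (.vertex i) • x := by
      rw [← mul_smul, gen_vertex_mul_self]
    refine ⟨.vertex i, ModuleCat.ofHom (SimpleModule.desc i _ hfix (h0 _)),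
      ModuleCat.ofHom (SimpleModule.lift i φ h0), ModuleCat.hom_ext (SimpleModule.hom_ext ?_)⟩
    change SimpleModule.lift i φ h0 (SimpleModule.desc i _ hfix (h0 _) (SimpleModule.one k i)) =
      SimpleModule.one k i
    apply (SimpleModule.coord k i).injective
    rw [SimpleModule.coord_lift_apply, SimpleModule.desc_apply, SimpleModule.coord_one, one_smul,
      hfix, hφ]
  · push Not at h0
    obtain ⟨x, i, j, h, hx⟩ := h0
    obtain ⟨φ, hφ⟩ := Module.Projective.exists_dual_eq_one k hx
    have hfix : gen k n (.vertex i) • gen k n (.vertex i) • x = gen k n (.vertex i) • x := by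
      rw [← mul_smul, gen_vertex_mul_self]
    refine ⟨.arrow i j h, ModuleCat.ofHom (ArrowModule.desc i j h _ hfix),
      ModuleCat.ofHom (ArrowModule.lift i j h φ), ModuleCat.hom_ext (ArrowModule.hom_ext ?_)⟩
    change ArrowModule.lift i j h φ (ArrowModule.desc i j h _ hfix (ArrowModule.one k i j h)) =
      ArrowModule.one k i j h
    have hone : ArrowModule.desc i j h _ hfix (ArrowModule.one k i j h) =
        gen k n (.vertex i) • x := by
      rw [ArrowModule.desc_apply, ArrowModule.top_one, ArrowModule.soc_one, one_smul, zero_smul,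
        add_zero]
    rw [hone]
    apply ArrowModule.ext
    · rw [ArrowModule.top_lift_apply, ← mul_smul, gen_arrow_mul_vertex, hφ, ArrowModule.top_one]
    · rw [ArrowModule.soc_lift_apply, vertex_smul_of_fixed hfix (by rintro rfl; omega), map_zero,
        ArrowModule.soc_one]

lemma IsExceptional.exists_iso_indec {M : ModuleCat.{u} (NakayamaAlgebra k n)}
    (hM : IsExceptional k M) : ∃ g : Gen n, Nonempty (M ≅ indec k g) := by
  obtain ⟨g, s, r, hsr⟩ := exists_indec_retract M
    (fun h => hM.indecomposable.1 (ModuleCat.isZero_iff_subsingleton.2 h))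
  exact ⟨g, isIso_of_retract (fun h => not_subsingleton_indec k g
    (ModuleCat.isZero_iff_subsingleton.1 ((Limits.IsZero.iff_id_eq_zero _).2 h)))
    hM.end_equiv s r hsr⟩

lemma IsExceptionalPair.before {M N : ModuleCat.{u} (NakayamaAlgebra k n)}
    (H : IsExceptionalPair k M N) {g h : Gen n} (e : M ≅ indec k g) (e' : N ≅ indec k h) :
    Before g h := by
  rw [← isExceptionalPair_indec_iff k]
  refine ⟨isExceptional_indec k g, isExceptional_indec k h, ?_, fun l hl => ?_⟩
  · have := H.hom_eq_zero
    exact (e'.homCongr e).symm.subsingleton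
  · have := H.ext_eq_zero l hl
    refine subsingleton_of_forall_eq 0 fun x => ?_
    -- Transport `x` to the Ext group of `N` and `M`, which is zero, and back.
    have hx : (Abelian.Ext.mk₀ e'.hom).comp (x.comp (Abelian.Ext.mk₀ e.inv) (add_zero l))
      (zero_add l) = 0 := Subsingleton.elim _ _
    have := congrArg (fun y => (Abelian.Ext.mk₀ e'.inv).comp
      (y.comp (Abelian.Ext.mk₀ e.hom) (add_zero l)) (zero_add l)) hx
    simpa using this

end Classification

/-- The complete exceptional sequences of the Nakayama algebra in terms of the indices of the
modules. -/
noncomputable def completeExceptionalSequencesEquiv (k : Type u) [Field k] (n : ℕ) :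
    {w : Fin n → Gen n // ∀ s t, s < t → Before (w s) (w t)} ≃ completeExceptionalSequences k n :=
  Equiv.ofBijective
    (fun w => ⟨fun t => isoClass (indec k (w.1 t)), fun t => indec k (w.1 t),
      ⟨fun t => isExceptional_indec k (w.1 t),
        fun s t hst => (isExceptionalPair_indec_iff k _ _).2 (w.2 s t hst)⟩, fun _ => rfl⟩) (by
    constructor
    · intro w w' h
      refine Subtype.ext (funext fun t => ?_)
      obtain ⟨e⟩ := Quotient.exact (congrFun (congrArg Subtype.val h) t)
      exact eq_of_indec_iso k e
    · rintro ⟨E, M, hM, hE⟩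
      choose w e using fun t => (hM.exceptional t).exists_iso_indec
      refine ⟨⟨w, fun s t hst => (hM.pair s t hst).before (e s).some (e t).some⟩,
        Subtype.ext (funext fun t => ?_)⟩
      exact (Quotient.sound ⟨(e t).some.symm⟩ : isoClass _ = isoClass (M t)).trans (hE t))


end Nakayama

/-! ### Ordering constraints, block numberings and idempotents -/

namespace Nakayama

variable {n : ℕ}

lemma before_vertex_vertex {a b : Fin n} : Before (.vertex a) (.vertex b) ↔ a < b := by
  simp only [Before, HomNonzero, ExtNonzero]; omega

lemma before_vertex_arrow {a i j : Fin n} {h : (i : ℕ) + 1 = j} :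
    Before (.vertex a) (.arrow i j h) ↔ a ≠ i := by
  simp only [Before, HomNonzero, ExtNonzero]; grind

lemma before_arrow_vertex {a i j : Fin n} {h : (i : ℕ) + 1 = j} :
    Before (.arrow i j h) (.vertex a) ↔ a ≠ j := by
  simp only [Before, HomNonzero, ExtNonzero]; grind

/-- For distinct edges only consecutive ones interact: the top of the higher module is the socle of
the lower one, so the higher one must come first. -/
lemma before_arrow_arrow {i j a b : Fin n} {h : (i : ℕ) + 1 = j} {h' : (a : ℕ) + 1 = b} :
    Before (.arrow i j h) (.arrow a b h') ↔ a ≠ i ∧ a ≠ j := by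
  simp only [Before, HomNonzero, ExtNonzero]; grind

lemma not_before_self (g : Gen n) : ¬ Before g g := by
  rcases g with i | ⟨i, j, h⟩ <;> simp [Before, HomNonzero]

/-- A monotone idempotent map, which sends every vertex to the root of its block, together with a
numbering of the vertices which is increasing on the roots and decreasing on every block. -/
structure BlockNumbering (n : ℕ) where
  root : Fin n → Fin n
  num : Equiv.Perm (Fin n)
  root_mono : Monotone root
  root_root : ∀ v, root (root v) = root v
  num_lt_of_root_lt : ∀ u v, root u < root v → num (root u) < num (root v)
  num_lt_of_root_eq : ∀ u v, root u = root v → u < v → num v < num u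

namespace BlockNumbering

@[ext] lemma ext {X Y : BlockNumbering n} (hr : X.root = Y.root) (hn : X.num = Y.num) : X = Y := by
  cases X; cases Y; simp_all

/-- The idempotent function on the numbers of the vertices induced by the root map. -/
def toIdempotent (X : BlockNumbering n) : idempotentFunctions n :=
  ⟨X.num ∘ X.root ∘ X.num.symm, by
    funext t
    simp [X.root_root]⟩

/-- The numbers of the vertices are ordered by their root and then decreasingly. -/
def key (f : Fin n → Fin n) (t : Fin n) : Fin n ×ₗ (Fin n)ᵒᵈ := toLex (f t, OrderDual.toDual t)

lemma key_lt_key {f : Fin n → Fin n} {s t : Fin n} :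
    key f s < key f t ↔ f s < f t ∨ f s = f t ∧ t < s := by
  simp [key, Prod.Lex.toLex_lt_toLex]

lemma key_injective (f : Fin n → Fin n) : Function.Injective (key f) := fun s t h => by
  simpa [key] using (Prod.ext_iff.1 (toLex.injective h)).2

/-- Thus the numbering lists the numbers in the order of their keys, and the keys depend only on the
idempotent. -/
lemma strictMono_key (X : BlockNumbering n) : StrictMono (key X.toIdempotent.1 ∘ X.num) := by
  intro u v huv
  simp only [Function.comp_apply, key_lt_key, toIdempotent, Equiv.symm_apply_apply]
  rcases (X.root_mono huv.le).lt_or_eq with h | h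
  · exact .inl (X.num_lt_of_root_lt u v h)
  · exact .inr ⟨by rw [h], X.num_lt_of_root_eq u v h huv⟩

/-- Strictly increasing maps with the same range agree, so the idempotent determines the numbering;
undoing the conjugation then recovers the root map. -/
lemma toIdempotent_injective : Function.Injective (toIdempotent (n := n)) := by
  intro X Y h
  have hX := X.strictMono_key
  have hY := Y.strictMono_key
  rw [h] at hX
  have hnum : X.num = Y.num := by
    have := (hX.range_inj hY).1 (by
      rw [Set.range_comp, Set.range_comp, X.num.surjective.range_eq, Y.num.surjective.range_eq])
    ext1 v
    exact key_injective _ (congrFun this v)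
  refine ext (funext fun v => ?_) hnum
  have := congrFun (congrArg Subtype.val h) (X.num v)
  simp only [toIdempotent, Function.comp_apply, Equiv.symm_apply_apply, hnum] at this
  exact Y.num.injective this

/-- The numbering is the permutation that sorts by key, and the root map is the conjugate of `f` by
it. -/
lemma toIdempotent_surjective : Function.Surjective (toIdempotent (n := n)) := by
  rintro ⟨f, hf⟩
  have hff : ∀ t, f (f t) = f t := congrFun hf
  let p := Tuple.sort (key f)
  have hp : StrictMono (key f ∘ p) :=
    (Tuple.monotone_sort (key f)).strictMono_of_injective
      ((key_injective f).comp p.injective)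
  have hlt : ∀ u v, u < v ↔ f (p u) < f (p v) ∨ f (p u) = f (p v) ∧ p v < p u := fun u v => by
    rw [← key_lt_key]
    exact hp.lt_iff_lt.symm
  refine ⟨⟨p.symm ∘ f ∘ p, p, ?_, ?_, ?_, ?_⟩, ?_⟩
  · intro u v huv
    by_contra! h
    rw [hlt] at h
    simp only [Function.comp_apply, Equiv.apply_symm_apply, hff] at h
    rcases huv.lt_or_eq with huv | rfl
    · rw [hlt] at huv
      grind
    · grind
  · intro v
    simp [hff]
  · intro u v h
    rw [hlt] at h
    change p (p.symm (f (p u))) < p (p.symm (f (p v)))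
    simp only [Function.comp_apply, Equiv.apply_symm_apply, hff] at h ⊢
    grind
  · intro u v h huv
    simp only [Function.comp_apply, EmbeddingLike.apply_eq_iff_eq] at h
    rw [hlt] at huv
    grind
  · ext t
    simp [toIdempotent]

/-! ### From block numberings to sequences of indices -/

variable (r : Fin n → Fin n)

/-- The index of an indecomposable module attached to a vertex: the simple module at a root, and the
module of length two attached to the first edge of the path from the vertex to its root
otherwise. -/
def label (v : Fin n) : Gen n :=
  if h : r v < v then .arrow ⟨v - 1, by omega⟩ v (by simp; omega)
  else if h : v < r v then .arrow v ⟨v + 1, by omega⟩ rfl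
  else .vertex v

variable {r}

lemma label_of_lt {v i : Fin n} (h : r v < v) (hi : (i : ℕ) + 1 = v) :
    label r v = .arrow i v hi := by
  rw [label, dif_pos h, Gen.arrow.injEq]
  exact ⟨Fin.ext (by simp; omega), rfl⟩

lemma label_of_gt {v j : Fin n} (h : v < r v) (hj : (v : ℕ) + 1 = j) :
    label r v = .arrow v j hj := by
  rw [label, dif_neg h.not_gt, dif_pos h, Gen.arrow.injEq]
  exact ⟨rfl, Fin.ext (by simp; omega)⟩

lemma label_of_eq {v : Fin n} (h : r v = v) : label r v = .vertex v := by
  rw [label, dif_neg (by omega), dif_neg (by omega)]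

/-- The possible values of the label of a vertex. -/
lemma label_cases (r : Fin n → Fin n) (v : Fin n) :
    (r v = v ∧ label r v = .vertex v) ∨
    (∃ (i : Fin n) (h : (i : ℕ) + 1 = v), r v ≤ i ∧ label r v = .arrow i v h) ∨
    (∃ (j : Fin n) (h : (v : ℕ) + 1 = j), j ≤ r v ∧ label r v = .arrow v j h) := by
  rcases lt_trichotomy (r v) v with h | h | h
  · have hi : ((⟨v - 1, by omega⟩ : Fin n) : ℕ) + 1 = v := by simp; omega
    exact .inr (.inl ⟨_, hi, by simp [Fin.le_def]; omega, label_of_lt h hi⟩)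
  · exact .inl ⟨h, label_of_eq h⟩
  · exact .inr (.inr ⟨⟨v + 1, by omega⟩, rfl, by simp [Fin.le_def]; omega, label_of_gt h rfl⟩)

/-- Two vertices could share a label only if they were the ends of an edge with each root lying on
the opposite side, which contradicts monotonicity. -/
lemma label_injective (hr : Monotone r) : Function.Injective (label r) := by
  intro u v h
  rcases label_cases r u with ⟨-, hu⟩ | ⟨i, hi, hiu, hu⟩ | ⟨i, hi, hiu, hu⟩ <;>
  rcases label_cases r v with ⟨-, hv⟩ | ⟨j, hj, hjv, hv⟩ | ⟨j, hj, hjv, hv⟩ <;>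
  rw [hu, hv] at h <;>
  simp only [Gen.vertex.injEq, Gen.arrow.injEq, reduceCtorEq] at h
  · exact h
  · exact h.2
  · obtain ⟨rfl, rfl⟩ := h
    have := hr (show i ≤ u by omega)
    omega
  · obtain ⟨rfl, rfl⟩ := h
    have := hr (show u ≤ i by omega)
    omega
  · exact h.1

/-- Two simples are in order because the numbering increases on roots. A violation of any other
constraint would involve neighbouring vertices of one block, where the numbering decreases, or roots
on incompatible sides. -/
lemma before_label (X : BlockNumbering n) {u v : Fin n} (h : X.num u < X.num v) :
    Before (label X.root u) (label X.root v) := by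
  have hmono := X.root_mono
  have huv : u ≠ v := by rintro rfl; exact lt_irrefl _ h
  have hroot : ∀ x y, X.root y = x → X.root x = x := by rintro _ y rfl; exact X.root_root y
  -- Blocks are convex: every vertex between `x` and its root has the same root.
  have hblock : ∀ x y, X.root x ≤ y → y ≤ x → X.root y = X.root x := fun x y h1 h2 =>
    le_antisymm (hmono h2) ((X.root_root x).symm.le.trans (hmono h1))
  have hblock' : ∀ x y, x ≤ y → y ≤ X.root x → X.root y = X.root x := fun x y h1 h2 =>
    le_antisymm ((hmono h2).trans (X.root_root x).le) (hmono h1)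
  have hdec := X.num_lt_of_root_eq
  rcases label_cases X.root u with ⟨hu, eu⟩ | ⟨i, hi, hiu, eu⟩ | ⟨i, hi, hiu, eu⟩ <;>
  rcases label_cases X.root v with ⟨hv, ev⟩ | ⟨j, hj, hjv, ev⟩ | ⟨j, hj, hjv, ev⟩ <;>
  rw [eu, ev] <;>
  simp only [before_vertex_vertex, before_vertex_arrow, before_arrow_vertex, before_arrow_arrow]
  · by_contra! hle
    have := X.num_lt_of_root_lt v u (by rw [hu, hv]; exact hle.lt_of_ne huv.symm)
    rw [hu, hv] at this
    exact lt_asymm h this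
  · rintro rfl
    have := hdec u v (hblock v u hjv (by omega)) (by omega)
    omega
  · exact huv
  · exact huv.symm
  · refine ⟨?_, ?_⟩
    · rintro rfl
      exact huv (Fin.ext (by omega))
    · rintro rfl
      have := hdec j v (hblock v j hjv (by omega)) (by omega)
      omega
  · refine ⟨?_, huv.symm⟩
    rintro rfl
    have h1 := hblock u v hiu (by omega)
    rw [h1] at hjv
    omega
  · rintro rfl
    have := hdec u v (hblock' u v (by omega) hiu).symm (by omega)
    omega
  · refine ⟨?_, ?_⟩
    · rintro rfl
      have h1 := hblock' j v (by omega) (by omega)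
      rw [h1] at hjv
      omega
    · rintro rfl
      have h1 := hblock' u j (by omega) hiu
      have h2 := hblock v j hjv (by omega)
      have := hdec u v (by rw [← h1, h2]) (by omega)
      omega
  · refine ⟨huv.symm, ?_⟩
    rintro rfl
    have := hdec u v (hblock' u v (by omega) hiu).symm (by omega)
    omega

/-- The sequence of indices attached to a block numbering. -/
def toSequence (X : BlockNumbering n) :
    {w : Fin n → Gen n // ∀ s t, s < t → Before (w s) (w t)} :=
  ⟨label X.root ∘ X.num.symm, fun s t hst => X.before_label (by simpa using hst)⟩

lemma range_toSequence (X : BlockNumbering n) :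
    Set.range X.toSequence.1 = Set.range (label X.root) := by
  rw [toSequence, Set.range_comp, X.num.symm.surjective.range_eq, Set.image_univ]

lemma vertex_mem_range_label {a : Fin n} : .vertex a ∈ Set.range (label r) ↔ r a = a := by
  refine ⟨?_, fun h => ⟨a, label_of_eq h⟩⟩
  rintro ⟨v, hv⟩
  rcases label_cases r v with ⟨h, e⟩ | ⟨i, hi, -, e⟩ | ⟨i, hi, -, e⟩ <;> rw [e] at hv
  · cases hv
    exact h
  · cases hv
  · cases hv

lemma arrow_mem_range_label (hr : Monotone r) (hrr : ∀ v, r (r v) = r v) {i j : Fin n}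
    {h : (i : ℕ) + 1 = j} : .arrow i j h ∈ Set.range (label r) ↔ r i = r j := by
  constructor
  · rintro ⟨v, hv⟩
    rcases label_cases r v with ⟨-, e⟩ | ⟨a, ha, hav, e⟩ | ⟨a, ha, hav, e⟩ <;> rw [e] at hv
    · cases hv
    · cases hv
      have h1 := hr hav
      have h2 := hr (show i ≤ j by omega)
      rw [hrr] at h1
      omega
    · cases hv
      have h1 := hr hav
      have h2 := hr (show i ≤ j by omega)
      rw [hrr] at h1
      omega
  · intro hij
    rcases lt_or_ge i (r i) with h' | h'
    · exact ⟨i, label_of_gt h' h⟩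
    · exact ⟨j, label_of_lt (by omega) h⟩

/-- The set of modules that occur records the roots and which consecutive vertices share a block,
and this determines the root map. Injectivity of the labels then determines the numbering. -/
lemma toSequence_injective : Function.Injective (toSequence (n := n)) := by
  intro X Y h
  have hrange : Set.range (label X.root) = Set.range (label Y.root) := by
    rw [← range_toSequence, ← range_toSequence, h]
  have hfix : ∀ a, X.root a = a ↔ Y.root a = a := fun a => by
    rw [← vertex_mem_range_label, ← vertex_mem_range_label, hrange]
  have hedge : ∀ i j : Fin n, (i : ℕ) + 1 = j → (X.root i = X.root j ↔ Y.root i = Y.root j) :=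
    fun i j hij => by
      rw [← arrow_mem_range_label X.root_mono X.root_root (h := hij),
        ← arrow_mem_range_label Y.root_mono Y.root_root (h := hij), hrange]
  -- By monotonicity, equal roots at both ends force equal roots in between, so the comparison of
  -- edges propagates along the interval.
  have hseg : ∀ (d : ℕ) (u v : Fin n), (u : ℕ) + d = v → X.root u = X.root v →
      Y.root u = Y.root v := by
    intro d
    induction d with
    | zero => intro u v huv _; rw [show u = v from Fin.ext huv]
    | succ d ih =>
      intro u v huv hX
      let w : Fin n := ⟨u + d, by omega⟩
      have h1 := X.root_mono (show u ≤ w by simp [Fin.le_def, w])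
      have h2 := X.root_mono (show w ≤ v by simp [Fin.le_def, w]; omega)
      rw [ih u w rfl (by omega)]
      exact (hedge w v (by simp [w]; omega)).1 (by omega)
  have hroot : X.root = Y.root := by
    funext v
    -- The `X`-root of `v` is a fixed point of `Y.root` in the same `Y`-block as `v`, hence also its
    -- `Y`-root.
    have hv : Y.root (X.root v) = X.root v := (hfix _).1 (X.root_root v)
    rw [← hv]
    rcases le_total v (X.root v) with h' | h'
    · exact (hseg (X.root v - v) v _ (by omega) (X.root_root v).symm).symm
    · exact hseg (v - X.root v) _ v (by omega) (X.root_root v)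
  refine ext hroot ?_
  have h2 : X.num.symm = Y.num.symm := by
    ext1 t
    refine label_injective X.root_mono ?_
    have := congrFun (congrArg Subtype.val h) t
    simpa [toSequence, hroot] using this
  simpa using congrArg Equiv.symm h2

end BlockNumbering

end Nakayama

namespace Nakayama

variable {n : ℕ}

/-! ### Blocks of a sequence satisfying the constraints -/

section Blocks

variable {w : Fin n → Gen n} (hw : ∀ s t, s < t → Before (w s) (w t))

include hw in
lemma injective_of_before : Function.Injective w := by
  intro s t h
  by_contra hne
  rcases lt_or_gt_of_ne hne with hlt | hlt
  · exact not_before_self (w t) (h ▸ hw s t hlt)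
  · exact not_before_self (w t) (h ▸ hw t s hlt)

include hw in
lemma le_of_not_before {s t : Fin n} (h : ¬ Before (w t) (w s)) : s ≤ t := by
  by_contra! hlt
  exact h (hw t s hlt)

/-- Every vertex has a last vertex in its block, where consecutive vertices `i` and `j` belong to
the same block if the module attached to `i ⟶ j` appears in the sequence. -/
lemma exists_last (w : Fin n → Gen n) (v : Fin n) : ∃ m : Fin n, v ≤ m ∧
    (∀ j h, .arrow m j h ∉ Set.range w) ∧
    ∀ u, v ≤ u → u < m → ∃ j h, .arrow u j h ∈ Set.range w := by
  obtain ⟨m, ⟨hm1, hm2⟩, hmin⟩ := wellFounded_lt.has_min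
    {m : Fin n | v ≤ m ∧ ∀ j h, .arrow m j h ∉ Set.range w}
    -- No arrow starts at the vertex of index `n - 1`, so a last vertex exists.
    ⟨⟨n - 1, by have := v.2; omega⟩, by simp [Fin.le_def]; omega, fun j h => by simp at h; omega⟩
  refine ⟨m, hm1, hm2, fun u hu hum => ?_⟩
  by_contra! H
  exact hmin u ⟨hu, H⟩ hum

/-- The last vertex of the block of a vertex. -/
noncomputable def last (w : Fin n → Gen n) (v : Fin n) : Fin n := (exists_last w v).choose

lemma le_last (v : Fin n) : v ≤ last w v := (exists_last w v).choose_spec.1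

lemma arrow_last_notMem (v j : Fin n) (h : (last w v : ℕ) + 1 = j) :
    .arrow (last w v) j h ∉ Set.range w :=
  (exists_last w v).choose_spec.2.1 j h

lemma arrow_mem_of_lt_last {u v j : Fin n} (huv : v ≤ u) (hu : u < last w v)
    (h : (u : ℕ) + 1 = j) : .arrow u j h ∈ Set.range w := by
  obtain ⟨j', h', hj⟩ := (exists_last w v).choose_spec.2.2 u huv hu
  obtain rfl : j = j' := Fin.ext (by omega)
  exact hj

lemma last_mono : Monotone (last w) := by
  intro u v huv
  by_contra! h
  have h1 := le_last (w := w) v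
  exact arrow_last_notMem v ⟨last w v + 1, by omega⟩ rfl
    (arrow_mem_of_lt_last (v := u) (by omega) h rfl)

lemma arrow_mem_of_last_eq {u m v j : Fin n} (h : last w u = last w v) (hum : u ≤ m) (hmv : m < v)
    (hj : (m : ℕ) + 1 = j) : .arrow m j hj ∈ Set.range w :=
  arrow_mem_of_lt_last hum (by have := le_last (w := w) v; omega) hj

include hw in
/-- Within a block, the modules of length two appear in decreasing order. -/
lemma arrow_le_arrow (d : ℕ) {s t u u' v v' : Fin n} (huv : (u : ℕ) + d = v)
    (hu : (u : ℕ) + 1 = u') (hv : (v : ℕ) + 1 = v') (hs : w s = .arrow u u' hu)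
    (ht : w t = .arrow v v' hv) (h : last w u = last w v) : t ≤ s := by
  induction d generalizing v v' t with
  | zero =>
    obtain rfl : u = v := Fin.ext huv
    obtain rfl : u' = v' := Fin.ext (by omega)
    exact (injective_of_before hw (hs.trans ht.symm)).symm.le
  | succ d ih =>
    let m : Fin n := ⟨u + d, by omega⟩
    have hmv : (m : ℕ) + 1 = v := by simp [m]; omega
    have h1 := last_mono (w := w) (show u ≤ m by simp [Fin.le_def, m])
    have h2 := last_mono (w := w) (show m ≤ v by omega)
    obtain ⟨q, hq⟩ := arrow_mem_of_last_eq h (show u ≤ m by simp [Fin.le_def, m])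
      (show m < v by omega) hmv
    -- The edge starting at `v` must precede the one starting at `m = v - 1`.
    refine le_trans (le_of_not_before hw ?_) (ih rfl hmv hq (by omega))
    rw [hq, ht, before_arrow_arrow]
    simp

include hw in
/-- A block contains at most one simple module of the sequence. -/
lemma not_lt_of_last_eq {a b : Fin n} (ha : .vertex a ∈ Set.range w)
    (hb : .vertex b ∈ Set.range w) (h : last w a = last w b) : ¬ a < b := by
  intro hab
  obtain ⟨s, hs⟩ := ha
  obtain ⟨t, ht⟩ := hb
  let a' : Fin n := ⟨a + 1, by omega⟩
  let c : Fin n := ⟨b - 1, by omega⟩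
  have hc : (c : ℕ) + 1 = b := by simp [c]; omega
  obtain ⟨p, hp⟩ := arrow_mem_of_last_eq h le_rfl hab (show (a : ℕ) + 1 = a' from rfl)
  obtain ⟨q, hq⟩ := arrow_mem_of_last_eq h (show a ≤ c by omega) (show c < b by omega) hc
  have h1 := last_mono (w := w) (show a ≤ c by omega)
  have h2 := last_mono (w := w) (show c ≤ b by omega)
  -- The inequalities `t ≤ q ≤ p ≤ s ≤ t` close a cycle through the two simples and the edges
  -- between them.
  have htq : t ≤ q := le_of_not_before hw (by rw [ht, hq, before_arrow_vertex]; simp)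
  have hqp : q ≤ p := arrow_le_arrow hw (c - a) (by omega) _ _ hp hq (by omega)
  have hps : p ≤ s := le_of_not_before hw (by rw [hp, hs, before_vertex_arrow]; simp)
  have hst : s ≤ t := le_of_not_before hw (by rw [ht, hs, before_vertex_vertex]; exact hab.not_gt)
  have : s = t := by omega
  subst this
  rw [hs] at ht
  cases ht
  exact lt_irrefl _ hab

include hw in
lemma eq_of_last_eq {a b : Fin n} (ha : .vertex a ∈ Set.range w)
    (hb : .vertex b ∈ Set.range w) (h : last w a = last w b) : a = b :=
  le_antisymm (not_lt.1 (not_lt_of_last_eq hw hb ha h.symm))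
    (not_lt.1 (not_lt_of_last_eq hw ha hb h))

include hw in
/-- In a sequence of full length, every block contains a simple module. -/
lemma exists_vertex_mem (v : Fin n) : ∃ a, .vertex a ∈ Set.range w ∧ last w a = last w v := by
  -- Count by sending a simple to the last vertex of its block and an edge to its source, which is
  -- never last in its block. On the `n` terms this is injective, hence surjective, and only a
  -- simple can hit a last vertex.
  let τ : Gen n → Fin n := fun g => match g with
    | .vertex a => last w a
    | .arrow i _ _ => i
  have hinj : Function.Injective (τ ∘ w) := by
    intro s t hst
    refine injective_of_before hw ?_
    have hs : w s ∈ Set.range w := ⟨s, rfl⟩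
    have ht : w t ∈ Set.range w := ⟨t, rfl⟩
    simp only [Function.comp_apply] at hst
    generalize w s = g at *
    generalize w t = g' at *
    rcases g with a | ⟨i, j, hij⟩ <;> rcases g' with b | ⟨c, d, hcd⟩ <;> simp only [τ] at hst
    · rw [eq_of_last_eq hw hs ht hst]
    · subst hst
      exact absurd ht (arrow_last_notMem a d hcd)
    · subst hst
      exact absurd hs (arrow_last_notMem b j hij)
    · subst hst
      obtain rfl : j = d := Fin.ext (by omega)
      rfl
  obtain ⟨t, ht⟩ := (Finite.injective_iff_surjective.1 hinj) (last w v)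
  have hmem : w t ∈ Set.range w := ⟨t, rfl⟩
  simp only [Function.comp_apply] at ht
  generalize w t = g at *
  rcases g with a | ⟨i, j, hij⟩ <;> simp only [τ] at ht
  · exact ⟨a, hmem, ht⟩
  · subst ht
    exact absurd hmem (arrow_last_notMem v j hij)

end Blocks

/-! ### Every such sequence comes from a block numbering -/

namespace BlockNumbering

/-- The root of a vertex is the vertex of the unique simple in its block, and its number is the
position of its label in the sequence. -/
lemma toSequence_surjective : Function.Surjective (toSequence (n := n)) := by
  rintro ⟨w, hw⟩
  choose r hr hrl using exists_vertex_mem hw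
  have hr_eq : ∀ u v, last w u = last w v → r u = r v := fun u v h =>
    eq_of_last_eq hw (hr u) (hr v) (by rw [hrl, hrl, h])
  have hmono : Monotone r := by
    intro u v huv
    by_contra! h
    have h1 := last_mono (w := w) h.le
    rw [hrl, hrl] at h1
    have h2 := hr_eq u v (le_antisymm (last_mono huv) h1)
    omega
  have hrr : ∀ v, r (r v) = r v := fun v => hr_eq _ _ (hrl v)
  have hmem : ∀ v, label r v ∈ Set.range w := by
    intro v
    rcases label_cases r v with ⟨h, e⟩ | ⟨i, hi, hiv, e⟩ | ⟨j, hj, hjv, e⟩ <;> rw [e]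
    · rw [← h]
      exact hr v
    · exact arrow_mem_of_last_eq (hrl v) hiv (by omega) hi
    · exact arrow_mem_of_last_eq (hrl v).symm le_rfl (by omega) hj
  choose p hp using hmem
  have hpinj : Function.Injective p := fun u v h =>
    label_injective hmono (by rw [← hp, ← hp, h])
  -- In each possible case, the labels of neighbouring vertices of a block violate the constraint if
  -- the lower vertex comes first.
  have hstep : ∀ u v : Fin n, (u : ℕ) + 1 = v → r u = r v → p v < p u := by
    intro u v huv h
    refine lt_of_le_of_ne (le_of_not_before hw ?_) (hpinj.ne (by omega))
    rw [hp, hp]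
    rcases label_cases r u with ⟨hu, eu⟩ | ⟨i, hi, hiu, eu⟩ | ⟨i, hi, hiu, eu⟩ <;>
    rcases label_cases r v with ⟨hv, ev⟩ | ⟨j, hj, hjv, ev⟩ | ⟨j, hj, hjv, ev⟩ <;>
    rw [eu, ev] <;>
    simp only [before_vertex_vertex, before_vertex_arrow, before_arrow_vertex,
      before_arrow_arrow] <;>
    omega
  have hdec : ∀ (d : ℕ) (u v : Fin n), (u : ℕ) + d + 1 = v → r u = r v → p v < p u := by
    intro d
    induction d with
    | zero => exact hstep
    | succ d ih =>
      intro u v huv h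
      let m : Fin n := ⟨u + d + 1, by omega⟩
      have h1 := hmono (show u ≤ m by simp [Fin.le_def, m]; omega)
      have h2 := hmono (show m ≤ v by simp [Fin.le_def, m]; omega)
      exact (hstep m v (by simp [m]; omega) (by omega)).trans (ih u m rfl (by omega))
  let X : BlockNumbering n :=
    { root := r
      num := Equiv.ofBijective p (Finite.injective_iff_bijective.1 hpinj)
      root_mono := hmono
      root_root := hrr
      num_lt_of_root_lt := fun u v h => by
        refine lt_of_le_of_ne (le_of_not_before hw ?_) (hpinj.ne h.ne)
        simp only [Equiv.ofBijective_apply]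
        rw [hp, hp, label_of_eq (hrr u), label_of_eq (hrr v), before_vertex_vertex]
        exact h.not_gt
      num_lt_of_root_eq := fun u v h huv => hdec (v - u - 1) u v (by omega) h }
  refine ⟨X, Subtype.ext (funext fun t => ?_)⟩
  obtain ⟨v, rfl⟩ := X.num.surjective t
  simp only [toSequence, Function.comp_apply, Equiv.symm_apply_apply]
  exact (hp v).symm

/-- Idempotent functions correspond to sequences of indices of indecomposable modules which satisfy
the ordering conditions. -/
noncomputable def idempotentEquivSequence (n : ℕ) : idempotentFunctions n ≃
    {w : Fin n → Gen n // ∀ s t, s < t → Before (w s) (w t)} :=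
  (Equiv.ofBijective toIdempotent ⟨toIdempotent_injective, toIdempotent_surjective⟩).symm.trans
    (Equiv.ofBijective toSequence ⟨toSequence_injective, toSequence_surjective⟩)

end BlockNumbering

end Nakayama

/-! ### Rooted forests of height at most one and idempotents -/

namespace RootedForest

@[ext] lemma ext {V : Type} {F G : RootedForest V} (hg : F.graph = G.graph)
    (hr : F.roots = G.roots) : F = G := by
  cases F; cases G; simp_all

variable {V : Type} (f : V → V)

/-- The graph which joins every element to its image. -/
def functionGraph : SimpleGraph V := SimpleGraph.fromRel fun u v => f u = v

variable {f}

lemma functionGraph_adj {u v : V} :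
    (functionGraph f).Adj u v ↔ u ≠ v ∧ (f u = v ∨ f v = u) :=
  SimpleGraph.fromRel_adj _ _ _

/-- Every vertex is equal or adjacent to its image, and by idempotence `f` is constant along edges.
-/
lemma functionGraph_reachable (hf : ∀ v, f (f v) = f v) {u v : V} :
    (functionGraph f).Reachable u v ↔ f u = f v := by
  have hroot : ∀ v, (functionGraph f).Reachable v (f v) := fun v => by
    by_cases h : v = f v
    · rw [← h]
    · exact (functionGraph_adj.2 ⟨h, .inl rfl⟩).reachable
  refine ⟨fun h => ?_, fun h => (hroot u).trans (h ▸ (hroot v).symm)⟩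
  obtain ⟨p⟩ := h
  induction p with
  | nil => rfl
  | cons h _ ih =>
    rw [← ih]
    rcases (functionGraph_adj.1 h).2 with h | h <;> rw [← h, hf]

/-- Every edge joins some `u` with `f u ≠ u` to `f u`. Nothing maps to a point that is not fixed, so
this is the only edge at `u`; deleting it isolates `u`, and the edge is a bridge. -/
lemma functionGraph_isAcyclic (hf : ∀ v, f (f v) = f v) : (functionGraph f).IsAcyclic := by
  have hbridge : ∀ u, ¬ f u = u →
      ¬ ((functionGraph f).deleteEdges {s(u, f u)}).Reachable u (f u) := by
    rintro u hu ⟨p⟩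
    generalize hz : f u = z at p hu
    obtain ⟨x, hx⟩ : ∃ x, ((functionGraph f).deleteEdges {s(u, z)}).Adj u x := by
      cases p with
      | nil => exact absurd rfl hu
      | cons h _ => exact ⟨_, h⟩
    subst hz
    rw [SimpleGraph.deleteEdges_adj, functionGraph_adj] at hx
    obtain ⟨⟨hne, rfl | rfl⟩, hx⟩ := hx
    · exact hx rfl
    · exact hu (hf x)
  rw [SimpleGraph.isAcyclic_iff_forall_adj_isBridge]
  intro u v huv
  obtain ⟨hne, rfl | rfl⟩ := functionGraph_adj.1 huv
  · rw [SimpleGraph.isBridge_iff]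
    exact hbridge u hne.symm
  · rw [Sym2.eq_swap, SimpleGraph.isBridge_iff]
    exact hbridge v hne

/-- The rooted forest of height at most one attached to an idempotent function. -/
def ofIdempotent (hf : ∀ v, f (f v) = f v) : RootedForest V where
  graph := functionGraph f
  roots := {v | f v = v}
  acyclic := functionGraph_isAcyclic hf
  existsUnique_root c := by
    induction c using SimpleGraph.ConnectedComponent.ind with | _ v => ?_
    refine ⟨f v, ⟨hf v, ?_⟩, fun r hr => ?_⟩
    · rw [SimpleGraph.ConnectedComponent.eq, functionGraph_reachable hf, hf]
    · obtain ⟨hr1, hr2⟩ := hr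
      rw [SimpleGraph.ConnectedComponent.eq, functionGraph_reachable hf] at hr2
      exact hr1.symm.trans hr2

lemma heightLE_ofIdempotent (hf : ∀ v, f (f v) = f v) : (ofIdempotent hf).HeightLE 1 := by
  intro r (hr : f r = r) v hrv
  have hv : f r = f v := (functionGraph_reachable hf).1 hrv
  by_cases h : r = v
  · subst h
    simp
  · have : (functionGraph f).Adj r v := functionGraph_adj.2 ⟨h, .inr (by rw [← hv, hr])⟩
    exact (SimpleGraph.dist_eq_one_iff_adj.2 this).le

variable (F : RootedForest V)

/-- The root of the component of a vertex. -/
noncomputable def root (v : V) : V :=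
  (F.existsUnique_root (F.graph.connectedComponentMk v)).choose

lemma root_mem (v : V) : F.root v ∈ F.roots :=
  (F.existsUnique_root (F.graph.connectedComponentMk v)).choose_spec.1.1

lemma reachable_root (v : V) : F.graph.Reachable (F.root v) v :=
  SimpleGraph.ConnectedComponent.exact
    (F.existsUnique_root (F.graph.connectedComponentMk v)).choose_spec.1.2

variable {F}

lemma eq_root {r v : V} (hr : r ∈ F.roots) (hrv : F.graph.Reachable r v) : r = F.root v :=
  (F.existsUnique_root (F.graph.connectedComponentMk v)).choose_spec.2 r
    ⟨hr, SimpleGraph.ConnectedComponent.sound hrv⟩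

lemma root_eq_self {v : V} : F.root v = v ↔ v ∈ F.roots :=
  ⟨fun h => h ▸ F.root_mem v, fun h => (eq_root h (SimpleGraph.Reachable.refl v)).symm⟩

lemma root_root (v : V) : F.root (F.root v) = F.root v := root_eq_self.2 (F.root_mem v)

lemma HeightLE.eq_or_adj_root (hF : F.HeightLE 1) (v : V) :
    F.root v = v ∨ F.graph.Adj (F.root v) v := by
  have h := hF _ (F.root_mem v) v (F.reachable_root v)
  rcases Nat.le_one_iff_eq_zero_or_eq_one.1 h with h | h
  · exact .inl ((F.reachable_root v).dist_eq_zero_iff.1 h)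
  · exact .inr (SimpleGraph.dist_eq_one_iff_adj.1 h)

/-- An edge between two vertices neither of which is the root would form a triangle with their
common root. -/
lemma HeightLE.functionGraph_root (hF : F.HeightLE 1) : functionGraph F.root = F.graph := by
  ext u v
  rw [functionGraph_adj]
  constructor
  · rintro ⟨hne, rfl | rfl⟩
    · exact ((hF.eq_or_adj_root u).resolve_left hne.symm).symm
    · exact (hF.eq_or_adj_root v).resolve_left hne
  · intro h
    refine ⟨h.ne, ?_⟩
    have huv : F.root u = F.root v := eq_root (F.root_mem u) ((F.reachable_root u).trans h.reachable)
    by_contra! H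
    have hu := (hF.eq_or_adj_root u).resolve_left fun e => H.2 (huv.symm.trans e)
    have hv := (hF.eq_or_adj_root v).resolve_left fun e => H.1 (huv.trans e)
    rw [← huv] at hv
    -- The edge and the detour through the root are two paths of lengths one and two with the same
    -- ends.
    have hp : (SimpleGraph.Walk.cons h SimpleGraph.Walk.nil).IsPath := by simp [h.ne]
    have hq : (SimpleGraph.Walk.cons hu.symm (SimpleGraph.Walk.cons hv .nil)).IsPath := by
      simp [hu.ne', h.ne, hv.ne]
    have := congrArg (fun p => p.1.length) ((F.acyclic.subsingleton_path u v).elim ⟨_, hp⟩ ⟨_, hq⟩)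
    simp at this

end RootedForest

/-- Labeled rooted forests of height at most one correspond to idempotent functions: every vertex is
sent to its root. -/
noncomputable def forestsEquivIdempotent (n : ℕ) : heightLEOneForests n ≃ idempotentFunctions n where
  toFun F := ⟨F.1.root, funext F.1.root_root⟩
  invFun f := ⟨.ofIdempotent (f := f.1) fun v => congrFun (show f.1 ∘ f.1 = f.1 from f.2) v,
    RootedForest.heightLE_ofIdempotent _⟩
  left_inv F := Subtype.ext (RootedForest.ext F.2.functionGraph_root
    (Set.ext fun _ => RootedForest.root_eq_self))
  right_inv f := Subtype.ext (funext fun v => by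
    have hf : ∀ v, f.1 (f.1 v) = f.1 v := congrFun (show f.1 ∘ f.1 = f.1 from f.2)
    exact (RootedForest.eq_root (F := .ofIdempotent hf) (hf v)
      ((RootedForest.functionGraph_reachable hf).2 (hf v))).symm)

theorem mainTheorem3 (k : Type u) [Field k] [IsAlgClosed k] (n : ℕ) :
    Nonempty (heightLEOneForests n ≃ idempotentFunctions n) ∧
    Nonempty (idempotentFunctions n ≃ Nakayama.completeExceptionalSequences k n) :=
  ⟨⟨forestsEquivIdempotent n⟩, ⟨(Nakayama.BlockNumbering.idempotentEquivSequence n).trans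
    (Nakayama.completeExceptionalSequencesEquiv k n)⟩⟩
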